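/- Let $B_n$ be the braid group on $n$ strands with standard generators $\sigma_1,\dots,\sigma_{n-1}$; $w(\beta)$ is the writhe (exponent sum) of $\beta\in B_n$, $\widehat\beta$ its closure and $\mu(\widehat\beta)$ the number of components of $\widehat\beta$. Let $P_L(v,z)$ be the Homflypt polynomial of oriented links, normalised by $P=1$ on the trivial knot and $P_{D_+}=vz\,P_{D_0}+v^2P_{D_-}$. Let $\nabla_L(z)=P_L(1,z)$ be the Conway polynomial, $V_L(t)=P_L\bigl(t,(t-1)/\sqrt t\bigr)$ the Jones polynomial, and $\Delta_L(t)=P_L\bigl(1,(t-1)/\sqrt t\bigr)$ the Alexander polynomial. For $p\in\mathbb Z$ let $C_p=\nabla_{\widehat{\sigma_1^p}}$ with $\sigma_1^p\in B_2$. **Lemma.** Let $\beta,\gamma\in B_3$, $a=w(\beta)$, $b=w(\gamma)$, and suppose $a>\max(b,-1)$ and $V_{\widehat\beta}=V_{\widehat\gamma}$. Then $\mu(\widehat\beta)\neq 3$, $\mu(\widehat\gamma)\ne 3$, and $a=b+2k$ for some integer $k\ge 1$. Moreover: 1. If $k=1$, then $\nabla_{\widehat\beta}=C_{a-1}$. 2.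 If $\widehat\beta$ is a knot and $k>1$, then $k=2$ and $a\ge 2$. If $a=2$, then $\nabla_{\widehat\beta}=1=\nabla_{\widehat\gamma}$. If $a>2$, then $a=2(4p+1)$ for some integer $p>0$, and $$t^{(a-2)/2}\Delta_{\widehat\beta}(t)=\sum_{j=0}^{2p-1}(-1)^jt^{4j}(1-t+t^3)+t^{8p},$$ $$t^{b/2}\Delta_{\widehat\gamma}(t)=1-t^2+t^3\sum_{j=0}^{2p-2}(-1)^jt^{4j}(1-t+t^3).$$ 3. If $\mu(\widehat\beta)=2$ and $k>1$, then $k$ is odd, $a=k(4p+3)$ for some integer $p\ge 0$, and $$t^{(a-2)/2}\Delta_{\widehat\beta}(t)=\sum_{j=0}^{p-1}t^{4kj}\Bigl[\sum_{x=0}^{k-1}t^{3x}(-1+t)+t^{3k-1}(-1+t^k)\Bigr]+t^{4kp}\sum_{x=0}^{k-1}t^{3x}(-1+t),$$ $$t^{b/2}\Delta_{\widehat\gamma}(t)=-(1-t^k)+t^{k+1}\sum_{j=0}^{p-1}t^{4kj}\Bigl[\sum_{x=0}^{k-1}t^{3x}(-1+t)+t^{3k-1}(-1+t^k)\Bigr],$$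 where sums with upper limit smaller than the lower limit are $0$. -/

import Mathlib

open scoped LaurentPolynomial

noncomputable section

/-! ### Braid groups, writhe, number of components of the closure -/

/-- The Artin relations on the generators `σ₀, …, σ_{n-2}` of the braid group on `n` strands. -/
def braidRels (n : ℕ) : Set (FreeGroup (Fin (n - 1))) :=
  {r | ∃ i j : Fin (n - 1),
    ((i : ℕ) + 1 < j ∧ r = (FreeGroup.of i * FreeGroup.of j) *
        (FreeGroup.of j * FreeGroup.of i)⁻¹) ∨
    ((i : ℕ) + 1 = j ∧ r = (FreeGroup.of i * FreeGroup.of j * FreeGroup.of i) *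
        (FreeGroup.of j * FreeGroup.of i * FreeGroup.of j)⁻¹)}

/-- The braid group `B_n` on `n` strands (Artin presentation). -/
abbrev BraidGroup (n : ℕ) : Type := PresentedGroup (braidRels n)

namespace BraidGroup

/-- The standard generator `σ_{i+1}` of `B_n`, numbered from `0`. -/
def sigma {n : ℕ} (i : Fin (n - 1)) : BraidGroup n := PresentedGroup.of i

/-- The writhe (exponent sum) as a homomorphism. -/
def writheHom (n : ℕ) : BraidGroup n →* Multiplicative ℤ :=
  PresentedGroup.toGroup (f := fun _ => Multiplicative.ofAdd (1 : ℤ)) (by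
    rintro r ⟨i, j, ⟨-, rfl⟩ | ⟨-, rfl⟩⟩ <;> simp)

/-- The writhe (exponent sum) of a braid. -/
def writhe {n : ℕ} (β : BraidGroup n) : ℤ := (writheHom n β).toAdd

/-- The underlying permutation of the strands: `σ_{i+1}` goes to the transposition `(i  i+1)`. -/
def perm (n : ℕ) : BraidGroup n →* Equiv.Perm (Fin n) :=
  PresentedGroup.toGroup
    (f := fun i : Fin (n - 1) => Equiv.swap (⟨i, by omega⟩ : Fin n) ⟨i + 1, by omega⟩) (by
    rintro r ⟨i, j, ⟨h, rfl⟩ | ⟨h, rfl⟩⟩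
    · simp only [map_mul, map_inv, FreeGroup.lift_apply_of, mul_inv_eq_one]
      ext x
      simp only [Equiv.Perm.mul_apply, Equiv.swap_apply_def, Fin.ext_iff]
      grind
    · simp only [map_mul, map_inv, FreeGroup.lift_apply_of, mul_inv_eq_one]
      ext x
      simp only [Equiv.Perm.mul_apply, Equiv.swap_apply_def, Fin.ext_iff]
      grind)

/-- The number `μ` of components of the closure of a braid: the number of cycles (fixed points
included) of the underlying permutation. -/
def numComponents {n : ℕ} (β : BraidGroup n) : ℕ :=
  Nat.card (Quotient (Equiv.Perm.SameCycle.setoid (perm n β)))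

end BraidGroup

/-! ### The Hecke algebra

For units `v, z` of a commutative ring `R`, the Hecke algebra `H_n` on `n + 1` strands is the
quotient of the group algebra of the braid group by the skein relation `σ_i² = v z σ_i + v²`.
It is free over `R`, and `H_{n+1}` has the basis `c_k · b`, where `b` runs over the basis of `H_n`
and `c_k = σ_k σ_{k+1} ⋯ σ_n` for `k = 0, …, n + 1` (so `c_{n+1} = 1`), generators being
numbered from `0`. -/

/-- The underlying module of the Hecke algebra on `n + 1` strands, in the coordinates of its
standard basis: `x : HeckeModule R (n + 1)` stands for `∑ k, c_k · x k`. -/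
def HeckeModule (R : Type) : ℕ → Type
  | 0 => R
  | n + 1 => Fin (n + 2) → HeckeModule R n

namespace HeckeModule

variable {R : Type} [CommRing R]

instance instAddCommGroup : (n : ℕ) → AddCommGroup (HeckeModule R n)
  | 0 => inferInstanceAs (AddCommGroup R)
  | n + 1 =>
    letI := instAddCommGroup n
    inferInstanceAs (AddCommGroup (Fin (n + 2) → HeckeModule R n))

instance instModule : (n : ℕ) → Module R (HeckeModule R n)
  | 0 => inferInstanceAs (Module R R)
  | n + 1 =>
    letI := instModule n
    inferInstanceAs (Module R (Fin (n + 2) → HeckeModule R n))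

/-- The Hecke algebra on one strand is `R`. -/
def scalar : HeckeModule R 0 ≃ₗ[R] R := LinearEquiv.refl R R

/-- The coordinates `x k` of `x = ∑ k, c_k · x k`. -/
def coords (n : ℕ) : HeckeModule R (n + 1) ≃ₗ[R] (Fin (n + 2) → HeckeModule R n) :=
  LinearEquiv.refl R (Fin (n + 2) → HeckeModule R n)

/-- The unit element of the Hecke algebra. -/
def one : (n : ℕ) → HeckeModule R n
  | 0 => scalar.symm 1
  | n + 1 => (coords n).symm (Pi.single (Fin.last (n + 1)) (one n))

/-- Left multiplication by the generator `σ_i`, `i < n`, on the Hecke algebra on `n + 1` strands: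
`σ_i c_i = v z c_i + v² c_{i+1}`, `σ_i c_{i+1} = c_i`, `σ_i c_k = c_k σ_i` for `k > i + 1`, and
`σ_i c_k = c_k σ_{i-1}` for `k < i`. -/
def gen (v z : Rˣ) : (n : ℕ) → ℕ → (HeckeModule R n →ₗ[R] HeckeModule R n)
  | 0, _ => LinearMap.id
  | n + 1, i =>
    (coords n).symm.toLinearMap ∘ₗ
      (LinearMap.pi fun k : Fin (n + 2) =>
        if (k : ℕ) = i then
          LinearMap.proj (k + 1) + ((v : R) * (z : R)) • LinearMap.proj k
        else if (k : ℕ) = i + 1 then ((v : R) ^ 2) • LinearMap.proj (k - 1)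
        else if i < (k : ℕ) then gen v z n i ∘ₗ LinearMap.proj k
        else gen v z n (i - 1) ∘ₗ LinearMap.proj k) ∘ₗ
      (coords n).toLinearMap

/-- The value `(1 - v²) / (v z)` of the two-component trivial link. -/
def delta (v z : Rˣ) : R := (1 - (v : R) ^ 2) * (↑(v * z)⁻¹ : R)

/-- The Ocneanu trace on the Hecke algebra on `n + 1` strands, normalised so as to be invariant
under both Markov stabilisations:
`tr_{n+1} b = δ · tr_n b` and `tr_{n+1} (c_k b) = tr_n (σ_k ⋯ σ_{n-1} b)` for `k ≤ n`,
`b` in the Hecke algebra on one strand less. -/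
def trace (v z : Rˣ) : (n : ℕ) → (HeckeModule R n →ₗ[R] R)
  | 0 => scalar.toLinearMap
  | n + 1 =>
    (delta v z • (trace v z n ∘ₗ LinearMap.proj (Fin.last (n + 1))) +
      ∑ k : Fin (n + 1), trace v z n ∘ₗ
        (((List.range' k (n - k)).map (gen v z n)).prod : Module.End R (HeckeModule R n)) ∘ₗ
          LinearMap.proj k.castSucc) ∘ₗ (coords n).toLinearMap

/-! The operators `gen v z n i` satisfy the Hecke relations, so the braid group acts. -/

theorem coords_gen (v z : Rˣ) (n i : ℕ) (x : HeckeModule R (n + 1)) (k : Fin (n + 2)) :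
    coords n (gen v z (n + 1) i x) k =
      if (k : ℕ) = i then coords n x (k + 1) + ((v : R) * (z : R)) • coords n x k
      else if (k : ℕ) = i + 1 then ((v : R) ^ 2) • coords n x (k - 1)
      else if i < (k : ℕ) then gen v z n i (coords n x k)
      else gen v z n (i - 1) (coords n x k) := by
  simp only [gen, LinearMap.comp_apply, LinearEquiv.coe_coe, LinearEquiv.apply_symm_apply,
    LinearMap.pi_apply]
  split_ifs <;> rfl

theorem gen_gen (v z : Rˣ) : ∀ (n i : ℕ), i < n → ∀ x : HeckeModule R n,
    gen v z n i (gen v z n i x) = ((v : R) * (z : R)) • gen v z n i x + ((v : R) ^ 2) • x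
  | 0, _, h, _ => absurd h (Nat.not_lt_zero _)
  | n + 1, i, h, x => by
    have ih := gen_gen v z n
    refine (coords n).injective (funext fun k => ?_)
    have hk := k.isLt
    have h1 : (k : ℕ) = i → ((k + 1 : Fin (n + 2)) : ℕ) = i + 1 := fun e => by
      rw [Fin.val_add_one_of_lt' (by omega), e]
    have h2 : (k : ℕ) = i + 1 → ((k - 1 : Fin (n + 2)) : ℕ) = i := fun e => by
      rw [Fin.val_sub_one_of_ne_zero (by intro h0; simp [h0] at e), e]; rfl
    simp only [map_add, map_smul, Pi.add_apply, Pi.smul_apply, coords_gen]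
    by_cases c1 : (k : ℕ) = i
    · simp [c1, h1 c1]
      abel
    by_cases c2 : (k : ℕ) = i + 1
    · simp [c2, h2 c2, smul_smul, mul_comm]
      abel
    by_cases c3 : i < (k : ℕ)
    · simp only [c1, c2, c3, if_true, if_false]
      exact ih i (by omega) _
    · simp only [c1, c2, c3, if_false]
      exact ih (i - 1) (by omega) _

theorem gen_comm (v z : Rˣ) : ∀ (n i j : ℕ), i + 1 < j → j < n → ∀ x : HeckeModule R n,
    gen v z n i (gen v z n j x) = gen v z n j (gen v z n i x)
  | 0, _, _, _, h, _ => absurd h (Nat.not_lt_zero _)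
  | n + 1, i, j, hij, h, x => by
    have ih := gen_comm v z n
    refine (coords n).injective (funext fun k => ?_)
    have hk := k.isLt
    have h1 : (k : ℕ) < n + 1 → ((k + 1 : Fin (n + 2)) : ℕ) = k + 1 := fun e => by
      rw [Fin.val_add_one_of_lt' (by omega)]
    have h2 : 0 < (k : ℕ) → ((k - 1 : Fin (n + 2)) : ℕ) = k - 1 := fun e => by
      rw [Fin.val_sub_one_of_ne_zero (by intro h0; simp [h0] at e)]
    simp only [coords_gen]
    by_cases c1 : (k : ℕ) = i
    · have := h1 (by omega)
      simp (disch := omega) only [this, if_pos, if_neg, map_add, map_smul]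
    by_cases c2 : (k : ℕ) = i + 1
    · have := h2 (by omega)
      simp (disch := omega) only [this, if_pos, if_neg, map_smul]
    by_cases c3 : (k : ℕ) < i
    · simp (disch := omega) only [if_neg]
      exact ih _ _ (by omega) (by omega) _
    by_cases c4 : (k : ℕ) = j
    · have := h1 (by omega)
      simp (disch := omega) only [this, if_pos, if_neg, map_add, map_smul]
    by_cases c5 : (k : ℕ) = j + 1
    · have := h2 (by omega)
      simp (disch := omega) only [this, if_pos, if_neg, map_smul]
    by_cases c6 : (k : ℕ) < j
    · simp (disch := omega) only [if_pos, if_neg]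
      exact ih _ _ (by omega) (by omega) _
    · simp (disch := omega) only [if_pos, if_neg]
      exact ih _ _ (by omega) (by omega) _

theorem gen_braid (v z : Rˣ) : ∀ (n i : ℕ), i + 1 < n → ∀ x : HeckeModule R n,
    gen v z n i (gen v z n (i + 1) (gen v z n i x)) =
      gen v z n (i + 1) (gen v z n i (gen v z n (i + 1) x))
  | 0, _, h, _ => absurd h (Nat.not_lt_zero _)
  | n + 1, i, h, x => by
    have ih := gen_braid v z n
    have hq := gen_gen v z n i (by omega)
    refine (coords n).injective (funext fun k => ?_)
    have hk := k.isLt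
    have h1 : ∀ k : Fin (n + 2), (k : ℕ) < n + 1 → ((k + 1 : Fin (n + 2)) : ℕ) = k + 1 :=
      fun k e => by rw [Fin.val_add_one_of_lt' (by omega)]
    have h2 : ∀ k : Fin (n + 2), 0 < (k : ℕ) → ((k - 1 : Fin (n + 2)) : ℕ) = k - 1 :=
      fun k e => by rw [Fin.val_sub_one_of_ne_zero (by intro h0; simp [h0] at e)]
    simp only [coords_gen]
    by_cases c1 : (k : ℕ) = i
    · have e1 := h1 k (by omega)
      have e2 := h1 (k + 1) (by omega)
      simp (disch := omega) only [e1, e2, if_pos, if_neg, map_add, map_smul, add_sub_cancel_right,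
        Nat.add_sub_cancel]
      simp only [hq, smul_add, smul_smul, pow_two, mul_comm, mul_left_comm]
      abel
    by_cases c2 : (k : ℕ) = i + 1
    · have e1 := h1 k (by omega)
      have e2 := h2 k (by omega)
      simp (disch := omega) only [e1, e2, if_pos, if_neg, map_add, map_smul, add_sub_cancel_right,
        sub_add_cancel, Nat.add_sub_cancel]
      simp only [smul_add, smul_smul, pow_two, mul_comm, mul_left_comm]
    by_cases c3 : (k : ℕ) = i + 2
    · have e1 := h2 k (by omega)
      have e2 := h2 (k - 1) (by omega)
      simp (disch := omega) only [e1, e2, if_pos, if_neg, map_add, map_smul, sub_add_cancel,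
        Nat.add_sub_cancel]
    by_cases c4 : (k : ℕ) < i
    · simp (disch := omega) only [if_neg]
      have := ih (i - 1) (by omega) (coords n x k)
      rwa [Nat.sub_add_cancel (by omega)] at this
    · simp (disch := omega) only [if_pos, if_neg]
      exact ih _ (by omega) _

/-- Left multiplication by `σ_i` as an automorphism; its inverse is left multiplication by
`σ_i⁻¹ = v⁻² (σ_i - v z)`. -/
def genEquiv (v z : Rˣ) (n : ℕ) (i : Fin n) : HeckeModule R n ≃ₗ[R] HeckeModule R n :=
  LinearEquiv.ofLinearMap (gen v z n i)
    (((v⁻¹ : Rˣ) : R) ^ 2 • (gen v z n i - ((v : R) * (z : R)) • LinearMap.id))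
    (by
      ext x
      have hv : ((v⁻¹ : Rˣ) : R) ^ 2 * (v : R) ^ 2 = 1 := by rw [← mul_pow]; simp
      simp [gen_gen v z n i i.isLt, smul_smul, hv])
    (by
      ext x
      have hv : ((v⁻¹ : Rˣ) : R) ^ 2 * (v : R) ^ 2 = 1 := by rw [← mul_pow]; simp
      simp [gen_gen v z n i i.isLt, smul_smul, hv])

/-- The action of the braid group on `n + 1` strands on the Hecke algebra by left
multiplication. -/
def rep (v z : Rˣ) (n : ℕ) :
    BraidGroup (n + 1) →* (HeckeModule R n ≃ₗ[R] HeckeModule R n) :=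
  PresentedGroup.toGroup (f := fun i : Fin n => genEquiv v z n i) (by
    rintro r ⟨i, j, ⟨h, rfl⟩ | ⟨h, rfl⟩⟩
    · simp only [map_mul, map_inv, FreeGroup.lift_apply_of, mul_inv_eq_one]
      ext x
      exact gen_comm v z n i j h j.isLt x
    · simp only [map_mul, map_inv, FreeGroup.lift_apply_of, mul_inv_eq_one]
      ext x
      have hj := j.isLt
      have := gen_braid v z n i (by omega) x
      rw [h] at this
      exact this)

end HeckeModule

/-! ### The link polynomials of closed braids -/

namespace BraidGroup

/-- The value at `(v, z)` of the Homflypt polynomial of the closure of a braid: the normalised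
Ocneanu trace of the image of the braid in the Hecke algebra. It satisfies
`P(β σ_i) = v z P(β) + v² P(β σ_i⁻¹)` and takes the value `1` on the trivial knot. -/
def homflypt {R : Type} [CommRing R] (v z : Rˣ) {n : ℕ} (β : BraidGroup (n + 1)) : R :=
  HeckeModule.trace v z n (HeckeModule.rep v z n β (HeckeModule.one n))

/-- The variable `z` as a unit of `ℤ[z, z⁻¹]`. -/
def zVar : (ℤ[T;T⁻¹])ˣ where
  val := LaurentPolynomial.T 1
  inv := LaurentPolynomial.T (-1)
  val_inv := by rw [← LaurentPolynomial.T_add]; simp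
  inv_val := by rw [← LaurentPolynomial.T_add]; simp

/-- The Conway polynomial `∇(z) = P(1, z)` of the closure of a braid. -/
def conway {n : ℕ} (β : BraidGroup (n + 1)) : ℤ[T;T⁻¹] := homflypt 1 zVar β

/-- `C_p = C_p(z)`, the Conway polynomial of the elementary torus link `K(p, 2)`, the closure of
the two-strand braid `σ₁ ^ p`. -/
def conwayTorus (p : ℤ) : ℤ[T;T⁻¹] := conway ((sigma 0 : BraidGroup 2) ^ p)

/-- The indeterminate `√t` of the field `ℚ(√t)`, in which the Jones and Alexander polynomials
are taken. -/
def sqrtT : (RatFunc ℚ)ˣ := Units.mk0 RatFunc.X RatFunc.X_ne_zero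

/-- The variable `t`. -/
def tVar : RatFunc ℚ := (sqrtT : RatFunc ℚ) ^ 2

theorem tVar_sub_one_ne_zero : tVar - 1 ≠ 0 := by
  have h : tVar - 1 = algebraMap (Polynomial ℚ) (RatFunc ℚ) (Polynomial.X ^ 2 - 1) := by
    simp [tVar, sqrtT]
  rw [h]
  refine RatFunc.algebraMap_ne_zero ?_
  exact (Polynomial.monic_X_pow_sub_C (1 : ℚ) two_ne_zero).ne_zero

/-- The unit `(t - 1) / √t`. -/
def skeinZ : (RatFunc ℚ)ˣ :=
  Units.mk0 ((tVar - 1) / (sqrtT : RatFunc ℚ))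
    (div_ne_zero tVar_sub_one_ne_zero sqrtT.ne_zero)

/-- The Jones polynomial `V(t) = P(t, (t - 1) / √t)` of the closure of a braid. -/
def jones {n : ℕ} (β : BraidGroup (n + 1)) : RatFunc ℚ := homflypt (sqrtT ^ 2) skeinZ β

/-- The Alexander polynomial `Δ(t) = P(1, (t - 1) / √t)` of the closure of a braid. -/
def alexander {n : ℕ} (β : BraidGroup (n + 1)) : RatFunc ℚ := homflypt 1 skeinZ β

end BraidGroup

end

/-! The Ocneanu trace on three strands is a combination of three characters of the Hecke algebra:
the two one-dimensional ones and that of the reduced Burau representation ψ. At v = t one weight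
vanishes, so V is (-√t)^a (t + t⁻¹ + tr ψ) (`homflypt_jones`). At v = 1 all three survive and give Δ
in terms of a and tr ψ (`homflypt_alexander`). Hence everything reduces to finding x = tr ψ(β).

Parity and values at t = 1 give a = b + 2k (`numComponents_eq`), and V_β = V_γ then makes tr ψ(γ) an
affine function of x, with coefficients depending only on t and k. Moreover ψ at t is conjugate to ψ
at t⁻¹ twisted by (-t)^w (`burauTrace_inv`). Writing the Jones relation at t and at t⁻¹ and
eliminating gives (`burauTrace_mul`) x (1 + t^k)(1 + t^(2k)) = -(t + t⁻¹)(t^(3k) + (-t)^a), so x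
depends only on a and k.

Since x is a Laurent polynomial, the right side must vanish at the roots of (1 + t^k)(1 + t^(2k)).
For k > 1 a primitive 4k-th root of unity, and for even a also its square, restrict a and k as
stated (`exponent_of_roots`). At t = 1 and even a the identity forces x = -1, whereas three
components would give x = 2. The formulas for Δ are what remains after dividing, written as
geometric sums; for k = 1 the factor 1 + t² cancels and leaves the polynomial of a two-strand torus
link. -/

namespace BraidGroup

/-! ### Writhe characters and representations of the three-strand braid group -/

section Writhe

theorem writhe_one (n : ℕ) : (1 : BraidGroup n).writhe = 0 := by
  simp [writhe]

theorem writhe_mul {n : ℕ} (α β : BraidGroup n) : (α * β).writhe = α.writhe + β.writhe := by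
  simp [writhe]

theorem writhe_sigma {n : ℕ} (i : Fin (n - 1)) : (sigma i : BraidGroup n).writhe = 1 := by
  simp [writhe, writheHom, sigma]

/-- The one-dimensional representation sending each generator to `u`. -/
def writheChar {G : Type*} [Group G] (u : G) (n : ℕ) : BraidGroup n →* G :=
  (zpowersHom G u).comp (writheHom n)

theorem writheChar_apply {G : Type*} [Group G] (u : G) {n : ℕ} (β : BraidGroup n) :
    writheChar u n β = u ^ β.writhe := by
  simp [writheChar, writhe, zpowersHom_apply]

end Writhe

/-- A representation of `B₃` from two elements satisfying the braid relation. -/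
def lift₃ {G : Type*} [Group G] (A B : G) (h : A * B * A = B * A * B) : BraidGroup 3 →* G :=
  PresentedGroup.toGroup (f := (![A, B] : Fin 2 → G)) (by
    rintro r ⟨i, j, ⟨hij, rfl⟩ | ⟨hij, rfl⟩⟩
    · omega
    · obtain rfl : i = 0 := by ext; simp; omega
      obtain rfl : j = 1 := by ext; simp at hij ⊢; omega
      rw [map_mul, map_inv, mul_inv_eq_one]
      simpa using h)

theorem lift₃_sigma_zero {G : Type*} [Group G] (A B : G) (h : A * B * A = B * A * B) :
    lift₃ A B h (sigma (n := 3) (0 : Fin 2)) = A :=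
  PresentedGroup.toGroup.of _

theorem lift₃_sigma_one {G : Type*} [Group G] (A B : G) (h : A * B * A = B * A * B) :
    lift₃ A B h (sigma (n := 3) (1 : Fin 2)) = B :=
  PresentedGroup.toGroup.of _

theorem hom₃_ext {G : Type*} [Group G] {φ ψ : BraidGroup 3 →* G}
    (h₀ : φ (sigma (n := 3) (0 : Fin 2)) = ψ (sigma (n := 3) (0 : Fin 2)))
    (h₁ : φ (sigma (n := 3) (1 : Fin 2)) = ψ (sigma (n := 3) (1 : Fin 2))) : φ = ψ :=
  PresentedGroup.ext fun i => by
    change Fin 2 at i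
    fin_cases i
    · exact h₀
    · exact h₁

/-! ### The reduced Burau representation and its trace -/

section Burau

variable {R S : Type*} [CommRing R] [CommRing S]

/-- The reduced Burau matrix of the first generator of `B₃`, multiplied by `l`. -/
def burauMatrix₁ (l t : Rˣ) : (Matrix (Fin 2) (Fin 2) R)ˣ where
  val := !![-(l * t : R), l; 0, l]
  inv := !![-(↑l⁻¹ * ↑t⁻¹ : R), ↑l⁻¹ * ↑t⁻¹; 0, ↑l⁻¹]
  val_inv := by
    ext i j; fin_cases i <;> fin_cases j <;> simp; all_goals grind [Units.mul_inv]
  inv_val := by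
    ext i j; fin_cases i <;> fin_cases j <;> simp; all_goals grind [Units.mul_inv]

/-- The reduced Burau matrix of the second generator of `B₃`, multiplied by `l`. -/
def burauMatrix₂ (l t : Rˣ) : (Matrix (Fin 2) (Fin 2) R)ˣ where
  val := !![(l : R), 0; l * t, -(l * t : R)]
  inv := !![(↑l⁻¹ : R), 0; ↑l⁻¹, -(↑l⁻¹ * ↑t⁻¹ : R)]
  val_inv := by
    ext i j; fin_cases i <;> fin_cases j <;> simp; all_goals grind [Units.mul_inv]
  inv_val := by
    ext i j; fin_cases i <;> fin_cases j <;> simp; all_goals grind [Units.mul_inv]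

/-- The reduced Burau representation of `B₃` at the parameter `t`, twisted by the character
`l ^ writhe`. -/
def burau (l t : Rˣ) : BraidGroup 3 →* (Matrix (Fin 2) (Fin 2) R)ˣ :=
  lift₃ (burauMatrix₁ l t) (burauMatrix₂ l t) (by
    ext i j
    fin_cases i <;> fin_cases j <;>
      simp [burauMatrix₁, burauMatrix₂] <;> ring)

theorem burau_sigma_zero (l t : Rˣ) :
    burau l t (sigma (n := 3) (0 : Fin 2)) = burauMatrix₁ l t := lift₃_sigma_zero ..

theorem burau_sigma_one (l t : Rˣ) :
    burau l t (sigma (n := 3) (1 : Fin 2)) = burauMatrix₂ l t := lift₃_sigma_one ..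

/-- The trace of the reduced Burau representation at the parameter `t`. -/
def burauTrace (t : Rˣ) (β : BraidGroup 3) : R := (burau 1 t β : Matrix (Fin 2) (Fin 2) R).trace

theorem trace_burau (l t : Rˣ) (β : BraidGroup 3) :
    (burau l t β : Matrix (Fin 2) (Fin 2) R).trace = ↑(l ^ β.writhe) * burauTrace t β := by
  have key : ∀ β : BraidGroup 3, (burau l t β : Matrix (Fin 2) (Fin 2) R) =
      (↑(l ^ β.writhe) : R) • (burau 1 t β : Matrix (Fin 2) (Fin 2) R) := by
    -- Scalar matrices are central, so multiplying a representation by a scalar character gives a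
    -- representation again; comparing on generators suffices.
    let c : Rˣ →* (Matrix (Fin 2) (Fin 2) R)ˣ := Units.map (Matrix.scalar (Fin 2)).toMonoidHom
    have hc : ∀ (u : Rˣ) (M : (Matrix (Fin 2) (Fin 2) R)ˣ), Commute (c u) M := fun u M =>
      Units.ext (Matrix.scalar_commute (u : R) (fun r => mul_comm _ _) M.val).eq
    let φ : BraidGroup 3 →* (Matrix (Fin 2) (Fin 2) R)ˣ :=
      { toFun := fun β => c (l ^ β.writhe) * burau 1 t β
        map_one' := by simp [writhe_one]
        map_mul' := fun α β => by
          rw [writhe_mul, zpow_add, map_mul, map_mul]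
          exact (hc _ _).mul_mul_mul_comm _ _ }
    have h : burau l t = φ := by
      refine hom₃_ext ?_ ?_
      · ext i j
        fin_cases i <;> fin_cases j <;> simp [φ, c, burau_sigma_zero, writhe_sigma, burauMatrix₁]
      · ext i j
        fin_cases i <;> fin_cases j <;> simp [φ, c, burau_sigma_one, writhe_sigma, burauMatrix₂]
    intro β
    rw [h]
    have hc' : (c (l ^ β.writhe)).val = Matrix.scalar (Fin 2) (↑(l ^ β.writhe) : R) := rfl
    change (c (l ^ β.writhe)).val * (burau 1 t β).val = _
    rw [hc', Matrix.scalar_apply, ← Matrix.smul_eq_diagonal_mul]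
  rw [key, Matrix.trace_smul, smul_eq_mul, burauTrace]

theorem map_burauTrace (f : R →+* S) (t : Rˣ) (β : BraidGroup 3) :
    f (burauTrace t β) = burauTrace (Units.map f t) β := by
  have h : (Units.map f.mapMatrix.toMonoidHom).comp (burau 1 t) =
      burau 1 (Units.map (f : R →* S) t) := by
    refine hom₃_ext ?_ ?_ <;> ext i j <;> fin_cases i <;> fin_cases j <;>
      simp [burau_sigma_zero, burau_sigma_one, burauMatrix₁, burauMatrix₂]
  have h2 := congrArg (fun M : (Matrix (Fin 2) (Fin 2) S)ˣ => M.val.trace)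
    (DFunLike.congr_fun h β)
  simp only [burauTrace]
  simp only [Matrix.trace, Matrix.diag, map_sum] at h2 ⊢
  simpa using h2

/-- In both representations, ψ at t and ψ at t⁻¹ twisted by (-t)^w, the generators have eigenvalues
1 and -t. The matrix `J` is an explicit intertwiner, of determinant 1 + t + t². -/
theorem burauTrace_inv {K : Type*} [Field K] (t : Kˣ) (ht : (1 + t + t ^ 2 : K) ≠ 0)
    (β : BraidGroup 3) :
    burauTrace t β = (-t : K) ^ β.writhe * burauTrace t⁻¹ β := by
  let J : (Matrix (Fin 2) (Fin 2) K)ˣ :=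
    Matrix.GeneralLinearGroup.mkOfDetNeZero !![1, -(1 + t : K); 1 + t, -t]
      (by rw [Matrix.det_fin_two_of]; convert ht using 1; ring)
  have hJ : (J : Matrix (Fin 2) (Fin 2) K) = !![1, -(1 + t : K); 1 + t, -t] := rfl
  have h : burau 1 t = (MulAut.conj J).toMonoidHom.comp (burau (-t) t⁻¹) := by
    refine hom₃_ext ?_ ?_
    · simp only [MonoidHom.comp_apply, MulEquiv.coe_toMonoidHom, MulAut.conj_apply]
      rw [eq_mul_inv_iff_mul_eq]
      ext i j
      rw [Units.val_mul, Units.val_mul, hJ]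
      fin_cases i <;> fin_cases j <;> simp [burau_sigma_zero, burauMatrix₁] <;> ring
    · simp only [MonoidHom.comp_apply, MulEquiv.coe_toMonoidHom, MulAut.conj_apply]
      rw [eq_mul_inv_iff_mul_eq]
      ext i j
      rw [Units.val_mul, Units.val_mul, hJ]
      fin_cases i <;> fin_cases j <;> simp [burau_sigma_one, burauMatrix₂] <;> ring
  rw [← Units.val_neg, ← Units.val_zpow_eq_zpow_val, ← trace_burau, burauTrace, h]
  simp only [MonoidHom.comp_apply, MulEquiv.coe_toMonoidHom, MulAut.conj_apply, Units.val_mul]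
  rw [Matrix.trace_units_conj]

/-- The action of a permutation on the root lattice of type `A₂`, in the basis of simple roots
`e₀ - e₁`, `e₁ - e₂`. -/
def rootAction (π : Equiv.Perm (Fin 3)) : Matrix (Fin 2) (Fin 2) ℤ :=
  let δ (i j : Fin 3) : ℤ := if π i = j then 1 else 0
  !![δ 0 0 - δ 1 0, δ 1 0 - δ 2 0; δ 1 2 - δ 0 2, δ 2 2 - δ 1 2]

theorem rootAction_mul : ∀ π ρ : Equiv.Perm (Fin 3),
    rootAction (π * ρ) = rootAction π * rootAction ρ := by
  decide

/-- At t = 1 the Burau matrices become reflections, so the representation factors through S₃. -/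
theorem burau_one_one (β : BraidGroup 3) :
    (burau (1 : ℤˣ) 1 β).val = rootAction (perm 3 β) := by
  let φ : Equiv.Perm (Fin 3) →* Matrix (Fin 2) (Fin 2) ℤ :=
    { toFun := rootAction, map_one' := by decide, map_mul' := rootAction_mul }
  have h : burau 1 1 = φ.toHomUnits.comp (perm 3) := by
    refine hom₃_ext ?_ ?_
    · rw [burau_sigma_zero]
      ext1
      simp only [MonoidHom.comp_apply, MonoidHom.coe_toHomUnits, sigma, perm,
        PresentedGroup.toGroup.of]
      decide
    · rw [burau_sigma_one]
      ext1
      simp only [MonoidHom.comp_apply, MonoidHom.coe_toHomUnits, sigma, perm,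
        PresentedGroup.toGroup.of]
      decide
  rw [h]
  rfl

instance (π : Equiv.Perm (Fin 3)) (i j : Fin 3) :
    Decidable ((Equiv.Perm.SameCycle.setoid π).r i j) :=
  inferInstanceAs (Decidable (π.SameCycle i j))

/-- The three cases are the conjugacy classes of S₃: 3-cycles, transpositions and the identity. Sign
and trace of the two-dimensional representation are class functions separating them, and the writhe
parity is the sign. -/
theorem numComponents_cases (β : BraidGroup 3) :
    (β.numComponents = 1 ∧ Even β.writhe ∧ burauTrace (1 : ℤˣ) β = -1) ∨
    (β.numComponents = 2 ∧ Odd β.writhe ∧ burauTrace (1 : ℤˣ) β = 0) ∨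
    (β.numComponents = 3 ∧ Even β.writhe ∧ burauTrace (1 : ℤˣ) β = 2) := by
  have hs : Equiv.Perm.sign (perm 3 β) = (-1) ^ β.writhe := by
    rw [← writheChar_apply, ← MonoidHom.comp_apply]
    refine DFunLike.congr_fun (hom₃_ext ?_ ?_) β
    · simp only [MonoidHom.comp_apply, writheChar_apply, sigma, perm,
        PresentedGroup.toGroup.of]
      decide
    · simp only [MonoidHom.comp_apply, writheChar_apply, sigma, perm,
        PresentedGroup.toGroup.of]
      decide
  have he : Even β.writhe ↔ Equiv.Perm.sign (perm 3 β) = 1 := by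
    rw [hs]
    rcases Int.even_or_odd β.writhe with h | h
    · simp [h, h.neg_one_zpow]
    · simp [h.neg_one_zpow, h]
  rw [← Int.not_even_iff_odd, he, burauTrace, burau_one_one, numComponents]
  generalize perm 3 β = π
  -- The cardinality is put in computable form, so that the claim can be checked on all six
  -- permutations.
  have hc : Nat.card (Quotient (Equiv.Perm.SameCycle.setoid π)) =
      @Fintype.card _ (@Quotient.fintype _ _ (Equiv.Perm.SameCycle.setoid π) fun i j =>
        inferInstanceAs (Decidable ((Equiv.Perm.SameCycle.setoid π).r i j))) :=
    @Nat.card_eq_fintype_card _ _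
  rw [hc]
  clear hc
  revert π
  decide

end Burau

end BraidGroup

/-! ### Coordinates and traces on the Hecke algebra -/

namespace HeckeModule

/-- The braids intertwined by `Φ` form a subgroup, inverses being included because `D` takes values
in units. Checking generators therefore suffices. -/
theorem rep_equivariant {R S : Type} [CommRing R] [Ring S] (v z : Rˣ) (n : ℕ)
    (D : BraidGroup (n + 1) →* Sˣ) (Φ : HeckeModule R n → S)
    (h : ∀ (i : Fin n) x, Φ (gen v z n i x) = D (PresentedGroup.of i) * Φ x)
    (β : BraidGroup (n + 1)) (x : HeckeModule R n) : Φ (rep v z n β x) = D β * Φ x := by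
  let H : Subgroup (BraidGroup (n + 1)) :=
    { carrier := {β | ∀ x, Φ (rep v z n β x) = D β * Φ x}
      one_mem' := fun x => by simp
      mul_mem' := fun {α β} hα hβ x => by
        rw [map_mul, map_mul, LinearEquiv.mul_apply, hα, hβ, Units.val_mul, mul_assoc]
      inv_mem' := fun {β} hβ x => by
        have := hβ (rep v z n β⁻¹ x)
        rw [← LinearEquiv.mul_apply, ← map_mul, mul_inv_cancel, map_one] at this
        change Φ x = _ at this
        rw [map_inv D, this, Units.inv_mul_cancel_left] }
  have hH : H = ⊤ := by
    rw [eq_top_iff, ← PresentedGroup.closure_range_of, Subgroup.closure_le]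
    rintro _ ⟨i, rfl⟩ x
    have : rep v z n (PresentedGroup.of i) = genEquiv v z n i := PresentedGroup.toGroup.of _
    rw [this]
    exact h i x
  have : β ∈ H := hH ▸ Subgroup.mem_top β
  exact this x

variable {R : Type} [CommRing R]

/-- The coordinates in the standard basis of the Hecke algebra on two strands. -/
def coords₁ (x : HeckeModule R 1) (k : Fin 2) : R := scalar (coords 0 x k)

/-- The coordinates in the standard basis of the Hecke algebra on three strands. -/
def coords₂ (x : HeckeModule R 2) (k : Fin 3) (l : Fin 2) : R := coords₁ (coords 1 x k) l

theorem coords₁_gen_zero (v z : Rˣ) (x : HeckeModule R 1) :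
    coords₁ (gen v z 1 0 x) 0 = coords₁ x 1 + v * z * coords₁ x 0 := by
  simp [coords₁, coords_gen]

theorem coords₁_gen_one (v z : Rˣ) (x : HeckeModule R 1) :
    coords₁ (gen v z 1 0 x) 1 = v ^ 2 * coords₁ x 0 := by
  simp [coords₁, coords_gen]

theorem coords₁_add (x y : HeckeModule R 1) (k : Fin 2) :
    coords₁ (x + y) k = coords₁ x k + coords₁ y k := by
  simp [coords₁]

theorem coords₁_smul (a : R) (x : HeckeModule R 1) (k : Fin 2) :
    coords₁ (a • x) k = a * coords₁ x k := by
  simp [coords₁]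

theorem coords₂_gen_zero (v z : Rˣ) (x : HeckeModule R 2) (k : Fin 3) (l : Fin 2) :
    coords₂ (gen v z 2 0 x) k l =
      ![![coords₂ x 1 0 + v * z * coords₂ x 0 0, coords₂ x 1 1 + v * z * coords₂ x 0 1],
        ![v ^ 2 * coords₂ x 0 0, v ^ 2 * coords₂ x 0 1],
        ![coords₂ x 2 1 + v * z * coords₂ x 2 0, v ^ 2 * coords₂ x 2 0]] k l := by
  fin_cases k <;> fin_cases l <;>
    simp [coords₂, coords_gen, coords₁_gen_zero, coords₁_gen_one, coords₁_add, coords₁_smul]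

theorem coords₂_gen_one (v z : Rˣ) (x : HeckeModule R 2) (k : Fin 3) (l : Fin 2) :
    coords₂ (gen v z 2 1 x) k l =
      ![![coords₂ x 0 1 + v * z * coords₂ x 0 0, v ^ 2 * coords₂ x 0 0],
        ![coords₂ x 2 0 + v * z * coords₂ x 1 0, coords₂ x 2 1 + v * z * coords₂ x 1 1],
        ![v ^ 2 * coords₂ x 1 0, v ^ 2 * coords₂ x 1 1]] k l := by
  fin_cases k <;> fin_cases l <;>
    simp [coords₂, coords_gen, coords₁_gen_zero, coords₁_gen_one, coords₁_add, coords₁_smul]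

theorem trace_one_eq (v z : Rˣ) (x : HeckeModule R 1) :
    trace v z 1 x = delta v z * coords₁ x 1 + coords₁ x 0 := by
  simp [trace, coords₁]

theorem trace_two_eq (v z : Rˣ) (x : HeckeModule R 2) :
    trace v z 2 x =
      delta v z * (delta v z * coords₂ x 2 1 + coords₂ x 2 0) +
      (delta v z * (v ^ 2 * coords₂ x 0 0) + (coords₂ x 0 1 + v * z * coords₂ x 0 0)) +
      (delta v z * coords₂ x 1 1 + coords₂ x 1 0) := by
  have : trace v z 2 x = delta v z * trace v z 1 (coords 1 x 2) +
      (trace v z 1 (gen v z 1 0 (coords 1 x 0)) + trace v z 1 (coords 1 x 1)) := by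
    rw [trace]
    simp [Fin.sum_univ_two]
  rw [this]
  simp only [trace_one_eq, coords₂, coords₁_gen_zero, coords₁_gen_one]
  ring

theorem coords₁_unit (k : Fin 2) : coords₁ (one 1 : HeckeModule R 1) k = ![0, 1] k := by
  fin_cases k <;> simp [coords₁, one]

theorem coords₂_unit (k : Fin 3) (l : Fin 2) :
    coords₂ (one 2 : HeckeModule R 2) k l = ![![0, 0], ![0, 0], ![0, 1]] k l := by
  fin_cases k <;> fin_cases l <;> simp [coords₂, coords₁, one] 

end HeckeModule

/-! ### The Homflypt polynomial as a combination of characters -/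

namespace BraidGroup
open HeckeModule

variable {K : Type} [Field K]

/-- The image of an element of the Hecke algebra on two strands in the one-dimensional
representation in which the generator acts as `u`. -/
def evalChar₁ (u : K) (x : HeckeModule K 1) : K := coords₁ x 0 * u + coords₁ x 1

theorem evalChar₁_rep (v z u : Kˣ) (hu : (u : K) ^ 2 = v * z * u + v ^ 2) (β : BraidGroup 2) :
    evalChar₁ (u : K) (rep v z 1 β (one 1)) = (u : K) ^ β.writhe := by
  rw [rep_equivariant v z 1 (writheChar u 2) (evalChar₁ (u : K)), writheChar_apply]
  · simp [evalChar₁, coords₁_unit]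
  · intro i x
    obtain rfl : i = 0 := Subsingleton.elim _ _
    have := writhe_sigma (n := 2) 0
    rw [sigma] at this
    rw [writheChar_apply, this, zpow_one]
    simp only [evalChar₁, Fin.val_zero, coords₁_gen_zero, coords₁_gen_one]
    linear_combination -(coords₁ x 0) * hu

/-- The image of an element of the Hecke algebra on three strands in the one-dimensional
representation in which the generators act as `u`. -/
def evalChar₂ (u : K) (x : HeckeModule K 2) : K :=
  evalChar₁ u (coords 1 x 0) * u ^ 2 + evalChar₁ u (coords 1 x 1) * u + evalChar₁ u (coords 1 x 2)

theorem evalChar₂_rep (v z u : Kˣ) (hu : (u : K) ^ 2 = v * z * u + v ^ 2) (β : BraidGroup 3) :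
    evalChar₂ (u : K) (rep v z 2 β (one 2)) = (u : K) ^ β.writhe := by
  rw [rep_equivariant v z 2 (writheChar u 3) (evalChar₂ (u : K)), writheChar_apply]
  · have := coords₂_unit (R := K)
    simp only [coords₂] at this
    simp [evalChar₂, evalChar₁, this]
  · intro i x
    have := writhe_sigma (n := 3) i
    rw [sigma] at this
    rw [writheChar_apply, this, zpow_one]
    have h0 := coords₂_gen_zero v z x
    have h1 := coords₂_gen_one v z x
    simp only [coords₂] at h0 h1
    fin_cases i
    · simp [evalChar₁, evalChar₂, h0]
      grind
    · simp [evalChar₁, evalChar₂, h1]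
      grind

/-- The image of an element of the Hecke algebra on three strands in the representation in which
the generators act as `A` and `B`. -/
def evalMatrix {m : Type*} [Fintype m] [DecidableEq m] (A B : Matrix m m K) (x : HeckeModule K 2) :
    Matrix m m K :=
  A * B * (coords₂ x 0 0 • A + coords₂ x 0 1 • 1) + B * (coords₂ x 1 0 • A + coords₂ x 1 1 • 1) +
    (coords₂ x 2 0 • A + coords₂ x 2 1 • 1)

theorem evalMatrix_rep (v s z : Kˣ) (hz : (z : K) = s - (s : K)⁻¹) (β : BraidGroup 3) :
    evalMatrix (burauMatrix₁ (-v / s) (s ^ 2)).val (burauMatrix₂ (-v / s) (s ^ 2)).val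
      (rep v z 2 β (one 2)) = burau (-v / s) (s ^ 2) β := by
  rw [rep_equivariant v z 2 (burau (-v / s) (s ^ 2)) (evalMatrix _ _)]
  · simp [evalMatrix, coords₂_unit]
  · intro i x
    have hs := s.ne_zero
    fin_cases i
    · have := burau_sigma_zero (-v / s) (s ^ 2)
      rw [sigma] at this
      simp only [Fin.zero_eta]
      erw [this]
      ext i j
      fin_cases i <;> fin_cases j <;>
      · simp [evalMatrix, coords₂_gen_zero, burauMatrix₁, burauMatrix₂, Matrix.one_fin_two, hz]
        field_simp
        ring
    · have := burau_sigma_one (-v / s) (s ^ 2)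
      rw [sigma] at this
      simp only [Fin.mk_one]
      erw [this]
      ext i j
      fin_cases i <;> fin_cases j <;>
      · simp [evalMatrix, coords₂_gen_one, burauMatrix₁, burauMatrix₂, Matrix.one_fin_two, hz]
        field_simp
        ring

/-- The twist -v/s at t = s² makes the generator eigenvalues v s and -v/s, which are the roots of u²
= v z u + v². -/
theorem trace_evalMatrix (v s z : Kˣ) (hz : (z : K) = s - (s : K)⁻¹) (β : BraidGroup 3) :
    (evalMatrix (burauMatrix₁ (-v / s) (s ^ 2)).val (burauMatrix₂ (-v / s) (s ^ 2)).val
      (rep v z 2 β (one 2))).trace = (-v / s : K) ^ β.writhe * burauTrace (s ^ 2) β := by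
  rw [evalMatrix_rep v s z hz, trace_burau]
  simp

/-- At v = s² the Ocneanu trace is the Burau character plus s² + s⁻² times the character u = -s; the
character u = s³ has weight zero. This is an identity of linear forms in the six coordinates. -/
theorem homflypt_jones (s z : Kˣ) (hz : (z : K) = s - (s : K)⁻¹) (β : BraidGroup 3) :
    homflypt (s ^ 2) z β = (-s : K) ^ β.writhe * (s ^ 2 + (s ^ 2 : K)⁻¹ + burauTrace (s ^ 2) β) := by
  have hs := s.ne_zero
  have h1 := trace_evalMatrix (s ^ 2) s z hz β
  have h2 := evalChar₂_rep (s ^ 2) z (-s) (by simp [hz]; field_simp; ring) β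
  have hsimp : -((s ^ 2 : Kˣ) : K) / s = -s := by simp; field_simp
  rw [hsimp] at h1
  rw [mul_add, ← h1, ← Units.val_neg, ← h2]
  have hz0 := z.ne_zero
  rw [hz] at hz0
  have hz1 : (s : K) ^ 2 - 1 ≠ 0 := fun h => hz0 (by field_simp; rw [h, mul_zero])
  have hd : delta (s ^ 2) z = - (s ^ 2 + 1 : K) / s := by
    rw [delta, Units.val_inv_eq_inv_val, Units.val_mul, hz]
    push_cast
    field_simp
    ring
  rw [homflypt, trace_two_eq, hd, hz]
  generalize rep (s ^ 2) z 2 β (one 2) = x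
  simp [evalMatrix, evalChar₂, evalChar₁, burauMatrix₁, burauMatrix₂, Matrix.trace_fin_two,
    Matrix.one_fin_two, coords₂]
  field_simp
  ring

/-- At v = 1 the value δ vanishes, and up to a common factor the trace is the sum of the characters
u = s and u = -s⁻¹ minus the Burau character. -/
theorem homflypt_alexander (s z : Kˣ) (hz : (z : K) = s - (s : K)⁻¹) (ht : (1 + s ^ 2 + s ^ 4 : K) ≠ 0)
    (β : BraidGroup 3) :
    homflypt 1 z β = (-(s : K)⁻¹) ^ β.writhe * (s ^ 2 / (1 + s ^ 2 + s ^ 4)) *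
      (1 - burauTrace (s ^ 2) β + (-s ^ 2 : K) ^ β.writhe) := by
  have hs := s.ne_zero
  have h1 := trace_evalMatrix 1 s z hz β
  have h2 := evalChar₂_rep 1 z (-s⁻¹) (by simp [hz]; field_simp; ring) β
  have h3 := evalChar₂_rep 1 z s (by simp [hz]; field_simp; ring) β
  have hsimp : -((1 : Kˣ) : K) / s = -(s : K)⁻¹ := by simp [neg_div]
  have e : (-(s : K)⁻¹) ^ β.writhe * (s ^ 2 / (1 + s ^ 2 + s ^ 4)) *
      (1 - burauTrace (s ^ 2) β + (-s ^ 2 : K) ^ β.writhe) = (s ^ 2 / (1 + s ^ 2 + s ^ 4)) *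
      ((-(s : K)⁻¹) ^ β.writhe - (-(s : K)⁻¹) ^ β.writhe * burauTrace (s ^ 2) β +
        ((-(s : K)⁻¹) * (-s ^ 2)) ^ β.writhe) := by
    rw [mul_zpow]; ring
  have e2 : (-(s : K)⁻¹) * (-s ^ 2) = s := by field_simp
  rw [hsimp] at h1
  rw [e, e2, ← h1, ← h3]
  rw [Units.val_neg, Units.val_inv_eq_inv_val] at h2
  rw [← h2, homflypt, trace_two_eq, hz]
  have hd : delta 1 z = 0 := by simp [delta]
  rw [hd]
  generalize rep 1 z 2 β (one 2) = x
  simp [evalMatrix, evalChar₂, evalChar₁, burauMatrix₁, burauMatrix₂, Matrix.trace_fin_two,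
    Matrix.one_fin_two, coords₂]
  field_simp
  ring

theorem homflypt_one_two (s z : Kˣ) (hz : (z : K) = s - (s : K)⁻¹) (ht : (1 + s ^ 2 : K) ≠ 0)
    (β : BraidGroup 2) :
    homflypt 1 z β = s / (1 + s ^ 2) * ((s : K) ^ β.writhe - (-(s : K)⁻¹) ^ β.writhe) := by
  have hs := s.ne_zero
  have h2 := evalChar₁_rep 1 z (-s⁻¹) (by simp [hz]; field_simp; ring) β
  have h3 := evalChar₁_rep 1 z s (by simp [hz]; field_simp; ring) β
  rw [Units.val_neg, Units.val_inv_eq_inv_val] at h2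
  rw [← h2, ← h3, homflypt, trace_one_eq]
  have hd : delta 1 z = 0 := by simp [delta]
  rw [hd]
  generalize rep 1 z 1 β (one 1) = x
  simp [evalChar₁]
  field_simp
  ring

end BraidGroup

/-! ### Change of coefficients -/

namespace HeckeModule

variable {R S : Type} [CommRing R] [CommRing S]

/-- Change of the coefficient ring. -/
def baseChange (f : R →+* S) : (n : ℕ) → HeckeModule R n →+ HeckeModule S n
  | 0 => (scalar.symm.toLinearMap.toAddMonoidHom.comp f.toAddMonoidHom).comp
      scalar.toLinearMap.toAddMonoidHom
  | n + 1 =>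
    { toFun := fun x => (coords n).symm fun k => baseChange f n (coords n x k)
      map_zero' := by
        refine (coords n).injective (funext fun k => ?_)
        simp
      map_add' := fun x y => by
        refine (coords n).injective (funext fun k => ?_)
        simp }

variable (f : R →+* S)

theorem scalar_baseChange (x : HeckeModule R 0) : scalar (baseChange f 0 x) = f (scalar x) := rfl

theorem coords_baseChange (n : ℕ) (x : HeckeModule R (n + 1)) (k : Fin (n + 2)) :
    coords n (baseChange f (n + 1) x) k = baseChange f n (coords n x k) := rfl

theorem baseChange_smul : ∀ (n : ℕ) (a : R) (x : HeckeModule R n),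
    baseChange f n (a • x) = f a • baseChange f n x
  | 0, a, x => scalar.injective (by simp [scalar_baseChange])
  | n + 1, a, x => (coords n).injective (funext fun k => by
      simp [coords_baseChange, baseChange_smul n])

theorem baseChange_unit : ∀ n : ℕ, baseChange f n (one n) = one n
  | 0 => scalar.injective (by simp [scalar_baseChange, one])
  | n + 1 => (coords n).injective (funext fun k => by
      by_cases h : k = Fin.last (n + 1)
      · subst h
        simp [coords_baseChange, one, baseChange_unit n]
      · simp [coords_baseChange, one, h])

variable (v z : Rˣ)

theorem baseChange_gen : ∀ (n i : ℕ) (x : HeckeModule R n),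
    baseChange f n (gen v z n i x) =
      gen (Units.map (f : R →* S) v) (Units.map (f : R →* S) z) n i (baseChange f n x)
  | 0, _, _ => rfl
  | n + 1, i, x => (coords n).injective (funext fun k => by
      rw [coords_baseChange, coords_gen, coords_gen]
      split_ifs <;> simp [coords_baseChange, baseChange_smul, baseChange_gen n])

theorem map_delta : f (delta v z) =
    delta (Units.map (f : R →* S) v) (Units.map (f : R →* S) z) := by
  rw [delta, delta, ← map_mul, ← map_inv]
  simp

theorem map_trace : ∀ (n : ℕ) (x : HeckeModule R n), f (trace v z n x) =
    trace (Units.map (f : R →* S) v) (Units.map (f : R →* S) z) n (baseChange f n x)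
  | 0, _ => rfl
  | n + 1, x => by
    have hl : ∀ (l : List ℕ) (y : HeckeModule R n),
        baseChange f n ((l.map (gen v z n)).prod y) =
        (l.map (gen (Units.map (f : R →* S) v) (Units.map (f : R →* S) z) n)).prod
          (baseChange f n y) := by
      intro l
      induction l with
      | nil => intro y; rfl
      | cons i l ih =>
        intro y
        rw [List.map_cons, List.prod_cons, List.map_cons, List.prod_cons, Module.End.mul_apply,
          Module.End.mul_apply, baseChange_gen, ih]
    simp [trace, map_trace n, hl, map_delta, coords_baseChange]

theorem baseChange_rep (n : ℕ) (β : BraidGroup (n + 1)) (x : HeckeModule R n) :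
    baseChange f n (rep v z n β x) =
      rep (Units.map (f : R →* S) v) (Units.map (f : R →* S) z) n β (baseChange f n x) := by
  let H : Subgroup (BraidGroup (n + 1)) :=
    { carrier := {β | ∀ x, baseChange f n (rep v z n β x) =
        rep (Units.map (f : R →* S) v) (Units.map (f : R →* S) z) n β (baseChange f n x)}
      one_mem' := fun x => by simp
      mul_mem' := fun {α β} hα hβ x => by
        rw [map_mul, map_mul, LinearEquiv.mul_apply, LinearEquiv.mul_apply, hα, hβ]
      inv_mem' := fun {β} hβ x => by
        refine (rep (Units.map (f : R →* S) v) (Units.map (f : R →* S) z) n β).injective ?_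
        rw [← hβ, ← LinearEquiv.mul_apply, ← LinearEquiv.mul_apply, ← map_mul, ← map_mul,
          mul_inv_cancel, map_one, map_one]
        rfl }
  have hH : H = ⊤ := by
    rw [eq_top_iff, ← PresentedGroup.closure_range_of, Subgroup.closure_le]
    rintro _ ⟨i, rfl⟩ x
    have : ∀ {Q : Type} [CommRing Q] (v z : Qˣ),
        rep v z n (PresentedGroup.of i) = genEquiv v z n i :=
      fun v z => PresentedGroup.toGroup.of _
    rw [this, this]
    exact baseChange_gen f v z n i x
  have : β ∈ H := hH ▸ Subgroup.mem_top β
  exact this x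

end HeckeModule

/-! ### Specialisation of Laurent polynomials -/

namespace BraidGroup
open HeckeModule

theorem map_homflypt {R S : Type} [CommRing R] [CommRing S] (f : R →+* S) (v z : Rˣ) {n : ℕ}
    (β : BraidGroup (n + 1)) :
    f (homflypt v z β) = homflypt (Units.map (f : R →* S) v) (Units.map (f : R →* S) z) β := by
  rw [homflypt, map_trace, baseChange_rep, baseChange_unit, homflypt]

noncomputable section

/-- Evaluation of integral Laurent polynomials at a unit. -/
def evalUnit {R : Type*} [CommRing R] (u : Rˣ) : ℤ[T;T⁻¹] →+* R :=
  LaurentPolynomial.eval₂ (Int.castRingHom R) u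

end

theorem map_evalUnit_zVar {R : Type*} [CommRing R] (u : Rˣ) :
    Units.map (evalUnit u : ℤ[T;T⁻¹] →* R) zVar = u := by
  ext
  simp [evalUnit, zVar, LaurentPolynomial.eval₂_T]

/-- A power of T turns a Laurent polynomial into a polynomial, and `hu` says that `u` is
transcendental. Identities proved in ℚ(√t) can thus be pulled back to ℤ[T;T⁻¹]. -/
theorem evalUnit_injective {K : Type*} [Field K] (C : ℚ →+* K) (u : Kˣ)
    (hu : ∀ q : Polynomial ℚ, q.eval₂ C u = 0 → q = 0) : Function.Injective (evalUnit u) := by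
  rw [injective_iff_map_eq_zero]
  intro p hp
  obtain ⟨n, q, hq⟩ := p.exists_T_pow
  have h0 : Polynomial.eval₂ (Int.castRingHom K) u q = 0 := by
    rw [← LaurentPolynomial.eval₂_toLaurent, hq, map_mul]
    change evalUnit u p * _ = 0
    rw [hp, zero_mul]
  have hq0 : q = 0 := by
    have h1 : (q.map (Int.castRingHom ℚ)).eval₂ C u = 0 := by
      rw [Polynomial.eval₂_map, ← h0]
      congr 1
      exact RingHom.ext_int _ _
    have h2 := hu _ h1
    exact (Polynomial.map_eq_zero_iff (Int.cast_injective)).1 h2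
  rw [hq0, map_zero] at hq
  have := congrArg (· * LaurentPolynomial.T (-(n : ℤ))) hq
  simp only [zero_mul, mul_assoc, ← LaurentPolynomial.T_add, add_neg_cancel,
    LaurentPolynomial.T_zero, mul_one] at this
  exact this.symm

theorem _root_.RatFunc.eval₂_X_eq_zero {F : Type*} [Field F] (q : Polynomial F)
    (h : q.eval₂ RatFunc.C RatFunc.X = 0) : q = 0 :=
  (transcendental_iff.1 RatFunc.transcendental_X) q h

theorem _root_.RatFunc.eval₂_X_sq_eq_zero {F : Type*} [Field F] (q : Polynomial F)
    (h : q.eval₂ RatFunc.C (RatFunc.X ^ 2) = 0) : q = 0 :=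
  (transcendental_iff.1 (RatFunc.transcendental_X.pow two_pos)) q h

theorem _root_.RatFunc.eval₂_eq_zero_of_ne_C {F : Type*} [Field F] {u : RatFunc F}
    (hu : ¬∃ c, u = RatFunc.C c) (q : Polynomial F) (h : q.eval₂ RatFunc.C u = 0) : q = 0 :=
  (transcendental_iff.1 (RatFunc.transcendental_of_ne_C _ hu)) q h

theorem eval₂_sqrtT_eq_zero (q : Polynomial ℚ)
    (h : q.eval₂ RatFunc.C (sqrtT : RatFunc ℚ) = 0) : q = 0 :=
  RatFunc.eval₂_X_eq_zero q h

theorem eval₂_tVar_eq_zero (q : Polynomial ℚ) (h : q.eval₂ RatFunc.C tVar = 0) : q = 0 :=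
  RatFunc.eval₂_X_sq_eq_zero q h

theorem skeinZ_val : (skeinZ : RatFunc ℚ) = sqrtT - (sqrtT : RatFunc ℚ)⁻¹ := by
  have := sqrtT.ne_zero
  rw [skeinZ, Units.val_mk0, tVar]
  field_simp

theorem eval₂_skeinZ_eq_zero (q : Polynomial ℚ)
    (h : q.eval₂ RatFunc.C (skeinZ : RatFunc ℚ) = 0) : q = 0 := by
  refine RatFunc.eval₂_eq_zero_of_ne_C ?_ q h
  clear h
  rintro ⟨c, hc⟩
  rw [skeinZ_val] at hc
  -- If √t - 1/√t were a constant c, then √t would be a root of X² - cX - 1, whose constant term is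
  -- not zero.
  have h : (Polynomial.X ^ 2 - Polynomial.C c * Polynomial.X - 1 : Polynomial ℚ).eval₂
      RatFunc.C (sqrtT : RatFunc ℚ) = 0 := by
    have := sqrtT.ne_zero
    simp only [Polynomial.eval₂_sub, Polynomial.eval₂_pow, Polynomial.eval₂_mul,
      Polynomial.eval₂_X, Polynomial.eval₂_C, Polynomial.eval₂_one, ← hc]
    field_simp
    ring
  have h2 := congrArg (Polynomial.eval 0) (eval₂_sqrtT_eq_zero _ h)
  simp at h2

theorem eval₂_tVar_ne_zero (q : Polynomial ℚ) (c : ℚ) (hq : q.eval c ≠ 0) :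
    q.eval₂ RatFunc.C tVar ≠ 0 := fun h => hq (by
  rw [eval₂_tVar_eq_zero _ h, Polynomial.eval_zero])

theorem tVar_pow_sub_one_ne_zero {k : ℕ} (hk : k ≠ 0) : tVar ^ k - 1 ≠ 0 := by
  have := eval₂_tVar_ne_zero (Polynomial.X ^ k - 1) 0 (by simp [hk])
  simpa only [Polynomial.eval₂_sub, Polynomial.eval₂_X_pow, Polynomial.eval₂_one] using this

theorem one_add_tVar_pow_ne_zero (k : ℕ) : 1 + tVar ^ k ≠ 0 := by
  have := eval₂_tVar_ne_zero (1 + Polynomial.X ^ k) 1 (by norm_num)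
  simpa only [Polynomial.eval₂_add, Polynomial.eval₂_X_pow, Polynomial.eval₂_one] using this

theorem one_add_tVar_add_sq_ne_zero : 1 + tVar + tVar ^ 2 ≠ 0 := by
  have := eval₂_tVar_ne_zero (1 + Polynomial.X + Polynomial.X ^ 2) 1 (by norm_num)
  simpa only [Polynomial.eval₂_add, Polynomial.eval₂_X_pow, Polynomial.eval₂_one,
    Polynomial.eval₂_X] using this

/-- The substitution z = (t - 1)/√t loses nothing, being transcendental over ℚ. -/
theorem conway_eq_iff {m n : ℕ} (β : BraidGroup (m + 1)) (γ : BraidGroup (n + 1)) :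
    β.conway = γ.conway ↔ β.alexander = γ.alexander := by
  have h : ∀ {n : ℕ} (β : BraidGroup (n + 1)), evalUnit skeinZ β.conway = β.alexander := by
    intro n β
    rw [conway, map_homflypt, map_evalUnit_zVar, map_one, alexander]
  rw [← h, ← h, (evalUnit_injective RatFunc.C skeinZ eval₂_skeinZ_eq_zero).eq_iff]

theorem conway_eq_one_iff {n : ℕ} (β : BraidGroup (n + 1)) :
    β.conway = 1 ↔ β.alexander = 1 := by
  rw [← (evalUnit_injective RatFunc.C skeinZ eval₂_skeinZ_eq_zero).eq_iff, conway, map_homflypt,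
    map_evalUnit_zVar, map_one, map_one, alexander]

theorem tVar_eq : ((sqrtT ^ 2 : (RatFunc ℚ)ˣ) : RatFunc ℚ) = tVar := rfl

theorem jones_eq (β : BraidGroup 3) : β.jones = (-sqrtT : RatFunc ℚ) ^ β.writhe *
    (tVar + tVar⁻¹ + burauTrace (sqrtT ^ 2) β) :=
  homflypt_jones sqrtT skeinZ skeinZ_val β

theorem alexander_eq (β : BraidGroup 3) : β.alexander = (-(sqrtT : RatFunc ℚ)⁻¹) ^ β.writhe *
    (tVar / (1 + tVar + tVar ^ 2)) *
      (1 - burauTrace (sqrtT ^ 2) β + (-tVar) ^ β.writhe) := by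
  have h : (sqrtT : RatFunc ℚ) ^ 4 = tVar ^ 2 := by rw [tVar]; ring
  have := one_add_tVar_add_sq_ne_zero
  rw [← h] at this ⊢
  exact homflypt_alexander sqrtT skeinZ skeinZ_val this β

theorem alexander_eq₂ (β : BraidGroup 2) : β.alexander = sqrtT / (1 + tVar) *
    ((sqrtT : RatFunc ℚ) ^ β.writhe - (-(sqrtT : RatFunc ℚ)⁻¹) ^ β.writhe) :=
  homflypt_one_two sqrtT skeinZ skeinZ_val (by simpa using one_add_tVar_pow_ne_zero 1 :
    1 + tVar ≠ 0) β

end BraidGroup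

/-! ### Roots of unity, and consequences of equal Jones polynomials -/

namespace BraidGroup

/-- If `(1 + t ^ k) (1 + t ^ (2 k))` divides `(1 + t ^ 2) (t ^ (3 k) + (-t) ^ a)`, as tested at the
roots of unity, then `a` and `k` are restricted. -/
theorem exponent_of_roots (k : ℕ) (hk : 1 < k) (a : ℤ)
    (H : ∀ ζ : ℂˣ, (1 + ζ ^ k : ℂ) * (1 + ζ ^ (2 * k)) = 0 →
      (1 + ζ ^ 2 : ℂ) = 0 ∨ (ζ ^ (3 * k) + ↑((-ζ) ^ a) : ℂ) = 0) :
    (Even a → k = 2 ∧ ∃ j : ℤ, a = 8 * j + 2) ∧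
    (Odd a → Odd k ∧ ∃ j : ℤ, a = k * (4 * j + 3)) := by
  have hk0 : 4 * k ≠ 0 := by omega
  obtain ⟨ζ, hζ⟩ : ∃ ζ : ℂˣ, IsPrimitiveRoot ζ (4 * k) := by
    have h := Complex.isPrimitiveRoot_exp (4 * k) hk0
    refine ⟨(h.isUnit hk0).unit, ?_⟩
    rw [← IsPrimitiveRoot.coe_units_iff]
    exact h
  have hζC : IsPrimitiveRoot (ζ : ℂ) (4 * k) := IsPrimitiveRoot.coe_units_iff.2 hζ
  have h2k : (ζ : ℂ) ^ (2 * k) = -1 :=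
    IsPrimitiveRoot.eq_neg_one_of_two_right (hζC.pow (by omega) (by ring))
  -- Otherwise ζ⁴ = 1, impossible for order 4k with k > 1.
  have h1 : (1 + ζ ^ 2 : ℂ) ≠ 0 := fun h => by
    have h4 : (ζ : ℂ) ^ 4 = 1 := by linear_combination (ζ ^ 2 - 1 : ℂ) * h
    have := Nat.le_of_dvd (by norm_num) (hζC.dvd_of_pow_eq_one 4 h4)
    omega
  have h2 := (H ζ (by rw [h2k]; ring)).resolve_left h1
  have hne : (-1 : ℂˣ) ≠ 1 := fun h => by
    have := congrArg Units.val h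
    norm_num at this
  constructor
  · intro ha
    rw [ha.neg_zpow] at h2
    have h3 : ζ ^ (3 * k : ℤ) = -ζ ^ a := by
      ext
      push_cast at h2 ⊢
      have : (ζ : ℂ) ^ (3 * k : ℤ) = ζ ^ (3 * k) := by norm_cast
      rw [this]
      linear_combination h2
    have h4 : ζ ^ (3 * k - a : ℤ) = -1 := by rw [zpow_sub, h3]; simp
    have h5 : ζ ^ ((3 * k - a) * 2 : ℤ) = 1 := by rw [zpow_mul, h4]; norm_num
    have d1 := (hζ.zpow_eq_one_iff_dvd _).1 h5
    have d2 : ¬ ((4 * k : ℕ) : ℤ) ∣ (3 * k - a : ℤ) := fun h =>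
      hne (by rw [← h4, (hζ.zpow_eq_one_iff_dvd _).2 h])
    -- For k ≠ 2 the square of ζ is also a root to which the hypothesis applies. Squaring ζ^(3k) =
    -- -ζ^a loses the sign, so the required sum becomes twice a power of ζ² and cannot vanish.
    have hk2 : k = 2 := by
      by_contra hk2
      have h6 : (1 + (ζ ^ 2 : ℂˣ) ^ 2 : ℂ) ≠ 0 := fun h => by
        have h8 : (ζ : ℂ) ^ 8 = 1 := by
          push_cast at h
          linear_combination (ζ ^ 4 - 1 : ℂ) * h
        obtain ⟨c, hc⟩ := hζC.dvd_of_pow_eq_one 8 h8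
        have : k * c = 2 := by linarith
        have := Nat.le_of_dvd (by norm_num) (Dvd.intro _ this)
        omega
      have h7 := (H (ζ ^ 2) (by
        push_cast
        rw [← pow_mul, h2k]; ring)).resolve_left h6
      rw [ha.neg_zpow] at h7
      have h8 : (ζ ^ 2) ^ (3 * k : ℤ) = (ζ ^ 2) ^ a := by
        rw [← mul_inv_eq_one, ← zpow_sub, ← h5, zpow_mul, ← zpow_natCast ζ 2]
        exact zpow_comm ζ 2 _
      have h9 : ((ζ ^ 2 : ℂˣ) : ℂ) ^ (3 * k) = ((ζ ^ 2 : ℂˣ) ^ a : ℂˣ) := by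
        rw [← h8]
        norm_cast
      rw [← h9] at h7
      have : ((ζ ^ 2 : ℂˣ) : ℂ) ^ (3 * k) = 0 := by linear_combination h7 / 2
      exact (ζ ^ 2).ne_zero (pow_eq_zero_iff (by omega) |>.1 this)
    subst hk2
    refine ⟨rfl, ?_⟩
    push_cast at d1 d2
    -- Here 8 divides 2(6 - a) but not 6 - a, so a ≡ 2 mod 8.
    exact ⟨(a - 2) / 8, by omega⟩
  · intro ha
    rw [ha.neg_zpow] at h2
    have h3 : ζ ^ (3 * k : ℤ) = ζ ^ a := by
      ext
      push_cast at h2 ⊢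
      have : (ζ : ℂ) ^ (3 * k : ℤ) = ζ ^ (3 * k) := by norm_cast
      rw [this]
      linear_combination h2
    have h4 : ζ ^ (3 * k - a : ℤ) = 1 := by rw [zpow_sub, h3]; simp
    obtain ⟨m, hm⟩ := (hζ.zpow_eq_one_iff_dvd _).1 h4
    push_cast at hm
    have haeq : a = k * (4 * (-m) + 3) := by linarith
    refine ⟨?_, -m, haeq⟩
    rw [haeq, Int.odd_mul] at ha
    exact_mod_cast ha.1

/-- Equality of the Jones polynomials, specialised to an arbitrary unit of a ring. -/
theorem burauTrace_relation {β γ : BraidGroup 3} (hV : β.jones = γ.jones)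
    {R : Type} [CommRing R] (s : Rˣ) :
    (((-s) ^ β.writhe : Rˣ) : R) *
        (↑(s ^ 2) + ↑(s ^ 2)⁻¹ + burauTrace (s ^ 2) β) =
      (((-s) ^ γ.writhe : Rˣ) : R) *
        (↑(s ^ 2) + ↑(s ^ 2)⁻¹ + burauTrace (s ^ 2) γ) := by
  have hev : ∀ {Q : Type} [CommRing Q] (u : Qˣ) (δ : BraidGroup 3),
      evalUnit u ((((-zVar) ^ δ.writhe : (ℤ[T;T⁻¹])ˣ) : ℤ[T;T⁻¹]) *
        (↑(zVar ^ 2) + ↑(zVar ^ 2)⁻¹ + burauTrace (zVar ^ 2) δ)) =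
      (((-u) ^ δ.writhe : Qˣ) : Q) * (↑(u ^ 2) + ↑(u ^ 2)⁻¹ + burauTrace (u ^ 2) δ) := by
    intro Q _ u δ
    have hv : ∀ w : (ℤ[T;T⁻¹])ˣ, evalUnit u (w : ℤ[T;T⁻¹]) =
      (Units.map (evalUnit u : ℤ[T;T⁻¹] →* Q) w : Q) := fun w => rfl
    have hneg : Units.map (evalUnit u : ℤ[T;T⁻¹] →* Q) (-zVar) = -u := by
      ext
      rw [← hv, Units.val_neg, map_neg, hv, map_evalUnit_zVar, Units.val_neg]
    rw [map_mul, map_add, map_add, map_burauTrace, hv, hv, hv, map_zpow, map_inv, map_pow,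
      map_evalUnit_zVar, hneg]
  -- The equality in ℚ(√t) already holds in ℤ[T;T⁻¹], from where it specialises to any unit of any
  -- ring.
  have hL := evalUnit_injective RatFunc.C sqrtT eval₂_sqrtT_eq_zero
    (a₁ := (((-zVar) ^ β.writhe : (ℤ[T;T⁻¹])ˣ) : ℤ[T;T⁻¹]) *
        (↑(zVar ^ 2) + ↑(zVar ^ 2)⁻¹ + burauTrace (zVar ^ 2) β))
    (a₂ := (((-zVar) ^ γ.writhe : (ℤ[T;T⁻¹])ˣ) : ℤ[T;T⁻¹]) *
        (↑(zVar ^ 2) + ↑(zVar ^ 2)⁻¹ + burauTrace (zVar ^ 2) γ)) (by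
      rw [hev, hev]
      rw [jones_eq, jones_eq] at hV
      simpa [tVar] using hV)
  rw [← hev s β, hL, hev s γ]

/-- Two closed three-braids with the same Jones polynomial have the same number of components, and
the writhes have the same parity. -/
theorem numComponents_eq {β γ : BraidGroup 3} (hV : β.jones = γ.jones) :
    β.numComponents = γ.numComponents ∧ Even (β.writhe - γ.writhe) := by
  -- At √t = 1 the two sides take the values 1, -2 or 4 for one, two or three components, so
  -- equality identifies the case.
  have h := burauTrace_relation hV (1 : ℤˣ)
  rw [one_pow] at h
  have hpow : ∀ a : ℤ, (Even a → (((-1 : ℤˣ) ^ a : ℤˣ) : ℤ) = 1) ∧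
      (Odd a → (((-1 : ℤˣ) ^ a : ℤˣ) : ℤ) = -1) := fun a =>
    ⟨fun h => by rw [h.neg_one_zpow]; rfl, fun h => by rw [h.neg_one_zpow]; rfl⟩
  rcases numComponents_cases β with ⟨n1, e1, t1⟩ | ⟨n1, e1, t1⟩ | ⟨n1, e1, t1⟩ <;>
    rcases numComponents_cases γ with ⟨n2, e2, t2⟩ | ⟨n2, e2, t2⟩ | ⟨n2, e2, t2⟩ <;>
    rw [t1, t2] at h <;>
    first
    | rw [(hpow _).1 e1, (hpow _).1 e2] at h
      first
      | exact ⟨n1.trans n2.symm, e1.sub e2⟩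
      | exact absurd h (by decide)
    | rw [(hpow _).2 e1, (hpow _).2 e2] at h
      exact ⟨n1.trans n2.symm, e1.sub_odd e2⟩
    | rw [(hpow _).1 e1, (hpow _).2 e2] at h
      exact absurd h (by decide)
    | rw [(hpow _).2 e1, (hpow _).1 e2] at h
      exact absurd h (by decide)

section

variable {K : Type} [Field K]

theorem burauTrace_of_jones {β γ : BraidGroup 3} (hV : β.jones = γ.jones) {k : ℕ}
    (hk : β.writhe = γ.writhe + 2 * (k : ℤ)) (s : Kˣ) :
    burauTrace (s ^ 2) γ = ((s ^ 2 : Kˣ) : K) ^ k *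
      (burauTrace (s ^ 2) β + (↑(s ^ 2) + (↑(s ^ 2) : K)⁻¹)) - (↑(s ^ 2) + (↑(s ^ 2) : K)⁻¹) := by
  have h := burauTrace_relation hV s
  have e : (-s) ^ β.writhe = (-s) ^ γ.writhe * (s ^ 2) ^ k := by
    rw [hk, zpow_add, zpow_mul, zpow_natCast]
    congr 2
    exact (even_two.neg_pow s)
  rw [e, Units.val_mul, mul_assoc, Units.mul_right_inj] at h
  simp only [Units.val_inv_eq_inv_val, Units.val_pow_eq_pow_val] at h ⊢
  linear_combination -h

/-- The trace of `β` is determined by the two writhes if the Jones polynomials agree: the relation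
between the traces holds at `t` and at `t⁻¹`. -/
theorem burauTrace_mul {β γ : BraidGroup 3} (hV : β.jones = γ.jones) {k : ℕ}
    (hk : β.writhe = γ.writhe + 2 * (k : ℤ)) (s : Kˣ)
    (h3 : (1 + ↑(s ^ 2) + ↑(s ^ 2) ^ 2 : K) ≠ 0) (hk1 : ((s ^ 2 : Kˣ) : K) ^ k - 1 ≠ 0) :
    burauTrace (s ^ 2) β * ((1 + ↑(s ^ 2) ^ k) * (1 + ↑(s ^ 2) ^ (2 * k))) =
      -((↑(s ^ 2) + (↑(s ^ 2) : K)⁻¹) * (↑(s ^ 2) ^ (3 * k) + (-↑(s ^ 2) : K) ^ β.writhe)) := by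
  have h1 := burauTrace_of_jones hV hk s
  -- Together with `hβ` and `hγ` this gives four linear equations in the traces of β and γ at t and
  -- t⁻¹.
  have h2 := burauTrace_of_jones hV hk s⁻¹
  have hβ := burauTrace_inv (s ^ 2) h3 β
  have hγ := burauTrace_inv (s ^ 2) h3 γ
  rw [inv_pow] at h2
  generalize s ^ 2 = t at *
  have ht := t.ne_zero
  have e : (-t : K) ^ β.writhe = (-t : K) ^ γ.writhe * ((t : K) ^ k) ^ 2 := by
    rw [hk, zpow_add₀ (neg_ne_zero.2 ht), zpow_mul, ← pow_mul, mul_comm k 2, pow_mul]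
    norm_cast
    simp
  rw [Units.val_inv_eq_inv_val, inv_inv, inv_pow] at h2
  rw [h1, h2] at hγ
  rw [e] at hβ ⊢
  rw [mul_comm 2 k, mul_comm 3 k, pow_mul, pow_mul]
  have hw : (t : K) ^ k ≠ 0 := pow_ne_zero _ ht
  generalize (t : K) ^ k = w at *
  generalize (-t : K) ^ γ.writhe = A at *
  generalize burauTrace t β = x at *
  generalize burauTrace t⁻¹ β = x' at *
  have hσ : (t : K)⁻¹ + t = t + (t : K)⁻¹ := add_comm _ _
  rw [hσ] at hγ
  generalize (t + (t : K)⁻¹ : K) = σ at *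
  -- With w = t^k, elimination produces the coefficient w⁴ - 1 = (w - 1)(1 + w)(1 + w²), and the
  -- right side is divisible by w - 1 too.
  refine mul_left_cancel₀ hk1 ?_
  have h4 : w * (w * (x + σ) - σ) = A * (x' + σ) - w * A * σ := by
    rw [hγ]
    field_simp
  linear_combination w ^ 2 * h4 - hβ

end

end BraidGroup

/-! ### Closed forms of the alternating and geometric sums -/

namespace BraidGroup

section

variable {K : Type*} [Field K]

theorem sum_alternating (t c : K) (n : ℕ) :
    (1 + t ^ 4) * ∑ j ∈ Finset.range n, (-1) ^ j * t ^ (4 * j) * c =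
      (1 - (-1) ^ n * t ^ (4 * n)) * c := by
  induction n with
  | zero => simp
  | succ n ih =>
    rw [Finset.sum_range_succ, mul_add, ih]
    ring

theorem sum_geometric (t c : K) (m n : ℕ) :
    (t ^ m - 1) * ∑ j ∈ Finset.range n, t ^ (m * j) * c = (t ^ (m * n) - 1) * c := by
  induction n with
  | zero => simp
  | succ n ih =>
    rw [Finset.sum_range_succ, mul_add, ih]
    ring

variable {t x : K}

/-- The factor 1 + t² cancels from `hx`. After multiplication by 1 + t⁴ the claim rests on (1 + t +
t²)(1 - t + t³) = 1 + t⁴ + t⁵. -/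
theorem knot_upper (ht : t ≠ 0) (p : ℕ) (h3 : 1 + t + t ^ 2 ≠ 0)
    (h2 : 1 + t ^ 2 ≠ 0) (h4 : 1 + t ^ 4 ≠ 0)
    (hx : x * ((1 + t ^ 2) * (1 + t ^ 4)) = -((t + t⁻¹) * (t ^ 6 + t ^ (8 * p + 2)))) :
    (1 - x + t ^ (8 * p + 2)) / (1 + t + t ^ 2) =
      ∑ j ∈ Finset.range (2 * p), (-1) ^ j * t ^ (4 * j) * (1 - t + t ^ 3) + t ^ (8 * p) := by
  have hs := sum_alternating t (1 - t + t ^ 3) (2 * p)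
  rw [pow_mul (-1 : K), neg_one_sq, one_pow, one_mul,
    show 4 * (2 * p) = 8 * p by ring] at hs
  rw [pow_add] at hx ⊢
  generalize t ^ (8 * p) = u at *
  generalize ∑ j ∈ Finset.range (2 * p), (-1) ^ j * t ^ (4 * j) * (1 - t + t ^ 3) = S at *
  rw [div_eq_iff h3]
  have hx' : x * (1 + t ^ 4) = -(t * (t ^ 4 + u)) := by
    refine mul_left_cancel₀ h2 ?_
    have : t * t⁻¹ = 1 := mul_inv_cancel₀ ht
    linear_combination hx - (t ^ 5 + t * u) * this
  refine mul_left_cancel₀ h4 ?_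
  linear_combination -hx' - (1 + t + t ^ 2) * hs

theorem knot_lower (ht : t ≠ 0) (p : ℕ) (hp : 0 < p) (h3 : 1 + t + t ^ 2 ≠ 0)
    (h2 : 1 + t ^ 2 ≠ 0) (h4 : 1 + t ^ 4 ≠ 0)
    (hx : x * ((1 + t ^ 2) * (1 + t ^ 4)) = -((t + t⁻¹) * (t ^ 6 + t ^ (8 * p + 2)))) :
    t * (1 - (t ^ 2 * (x + (t + t⁻¹)) - (t + t⁻¹)) + t ^ (8 * p - 2)) / (1 + t + t ^ 2) =
      1 - t ^ 2 + t ^ 3 *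
        ∑ j ∈ Finset.range (2 * p - 1), (-1) ^ j * t ^ (4 * j) * (1 - t + t ^ 3) := by
  -- This removes the truncated subtractions 2p - 1 and 8p - 2; the number of summands is now
  -- visibly odd, which flips the sign in the alternating sum.
  obtain ⟨q, rfl⟩ : ∃ q, p = q + 1 := ⟨p - 1, by omega⟩
  have hs := sum_alternating t (1 - t + t ^ 3) (2 * q + 1)
  rw [pow_succ (-1 : K), pow_mul (-1 : K), neg_one_sq, one_pow,
    show 4 * (2 * q + 1) = 8 * q + 4 by ring, pow_add] at hs
  rw [show 2 * (q + 1) - 1 = 2 * q + 1 by omega, show 8 * (q + 1) - 2 = 8 * q + 6 by omega, pow_add]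
  rw [show 8 * (q + 1) + 2 = 8 * q + 10 by omega, pow_add] at hx
  generalize t ^ (8 * q) = u at *
  generalize ∑ j ∈ Finset.range (2 * q + 1), (-1) ^ j * t ^ (4 * j) * (1 - t + t ^ 3) = S at *
  rw [div_eq_iff h3]
  have hi : t * t⁻¹ = 1 := mul_inv_cancel₀ ht
  have hx' : x * (1 + t ^ 4) = -(t * (t ^ 4 + t ^ 8 * u)) := by
    refine mul_left_cancel₀ h2 ?_
    linear_combination hx - (t ^ 5 + t ^ 9 * u) * hi
  refine mul_left_cancel₀ h4 ?_
  linear_combination -t ^ 3 * hx' - t ^ 3 * (1 + t + t ^ 2) * hs + (1 + t ^ 4) * (1 - t ^ 2) * hi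

/-- With w = t^k and inner sum Q, one has (1 + t + t²) Q = w³ - 1. The outer sum has ratio w⁴, so
multiplying by w⁴ - 1, split into its three factors, clears every denominator. -/
theorem link_upper (ht : t ≠ 0) (k p : ℕ) (hk : 0 < k) (h3 : 1 + t + t ^ 2 ≠ 0) (h1 : t - 1 ≠ 0)
    (hk1 : t ^ k - 1 ≠ 0) (hk2 : 1 + t ^ k ≠ 0) (hk4 : 1 + t ^ (2 * k) ≠ 0)
    (hx : x * ((1 + t ^ k) * (1 + t ^ (2 * k))) =
      -((t + t⁻¹) * (t ^ (3 * k) - t ^ (k * (4 * p + 3))))) :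
    -((1 - x - t ^ (k * (4 * p + 3))) / (1 + t + t ^ 2)) =
      ∑ j ∈ Finset.range p, t ^ (4 * k * j) *
          (∑ x ∈ Finset.range k, t ^ (3 * x) * (-1 + t) + t ^ (3 * k - 1) * (-1 + t ^ k)) +
        t ^ (4 * k * p) * ∑ x ∈ Finset.range k, t ^ (3 * x) * (-1 + t) := by
  have hq := sum_geometric t (-1 + t) 3 k
  generalize ∑ x ∈ Finset.range k, t ^ (3 * x) * (-1 + t) = Q at *
  have hi : t * t⁻¹ = 1 := mul_inv_cancel₀ ht
  have e1 : t ^ (3 * k - 1) = (t ^ k) ^ 3 * t⁻¹ := by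
    rw [pow_sub₀ _ ht (by omega), ← pow_mul, mul_comm k 3, pow_one]
  have hs := sum_geometric t (Q + t ^ (3 * k - 1) * (-1 + t ^ k)) (4 * k) p
  generalize ∑ j ∈ Finset.range p, t ^ (4 * k * j) * (Q + t ^ (3 * k - 1) * (-1 + t ^ k)) = S at *
  rw [e1] at hs
  have e2 : t ^ (4 * k) = (t ^ k) ^ 4 := by rw [← pow_mul, mul_comm]
  have e3 : t ^ (k * (4 * p + 3)) = t ^ (4 * k * p) * (t ^ k) ^ 3 := by
    rw [← pow_mul, ← pow_add]; ring
  have e4 : t ^ (2 * k) = (t ^ k) ^ 2 := by rw [← pow_mul, mul_comm]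
  have e5 : t ^ (3 * k) = (t ^ k) ^ 3 := by rw [← pow_mul, mul_comm]
  rw [e2] at hs
  rw [e3, e4, e5] at hx
  rw [e3]
  rw [e4] at hk4
  rw [e5] at hq
  generalize t ^ (4 * k * p) = u at *
  generalize t ^ k = w at *
  have hq' : (1 + t + t ^ 2) * Q = w ^ 3 - 1 := by
    refine mul_left_cancel₀ h1 ?_
    linear_combination hq
  rw [neg_eq_iff_eq_neg, div_eq_iff h3]
  refine mul_left_cancel₀ hk1 ?_
  refine mul_left_cancel₀ hk2 ?_
  refine mul_left_cancel₀ hk4 ?_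
  generalize t⁻¹ = r at *
  linear_combination -(w - 1) * hx + (1 + t + t ^ 2) * hs +
    ((u - 1) + (w ^ 4 - 1) * u) * hq' + (u - 1) * (w - 1) * w ^ 3 * (1 + t) * hi

theorem link_lower (ht : t ≠ 0) (k p : ℕ) (hk : 0 < k) (h3 : 1 + t + t ^ 2 ≠ 0) (h1 : t - 1 ≠ 0)
    (hk1 : t ^ k - 1 ≠ 0) (hk2 : 1 + t ^ k ≠ 0) (hk4 : 1 + t ^ (2 * k) ≠ 0)
    (hx : x * ((1 + t ^ k) * (1 + t ^ (2 * k))) =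
      -((t + t⁻¹) * (t ^ (3 * k) - t ^ (k * (4 * p + 3))))) :
    -(t * (1 - (t ^ k * (x + (t + t⁻¹)) - (t + t⁻¹)) - t ^ (k * (4 * p + 1))) /
        (1 + t + t ^ 2)) =
      -(1 - t ^ k) + t ^ (k + 1) *
        ∑ j ∈ Finset.range p, t ^ (4 * k * j) *
          (∑ x ∈ Finset.range k, t ^ (3 * x) * (-1 + t) + t ^ (3 * k - 1) * (-1 + t ^ k)) := by
  have hq := sum_geometric t (-1 + t) 3 k
  generalize ∑ x ∈ Finset.range k, t ^ (3 * x) * (-1 + t) = Q at *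
  have hi : t * t⁻¹ = 1 := mul_inv_cancel₀ ht
  have e1 : t ^ (3 * k - 1) = (t ^ k) ^ 3 * t⁻¹ := by
    rw [pow_sub₀ _ ht (by omega), ← pow_mul, mul_comm k 3, pow_one]
  have hs := sum_geometric t (Q + t ^ (3 * k - 1) * (-1 + t ^ k)) (4 * k) p
  generalize ∑ j ∈ Finset.range p, t ^ (4 * k * j) * (Q + t ^ (3 * k - 1) * (-1 + t ^ k)) = S at *
  rw [e1] at hs
  have e2 : t ^ (4 * k) = (t ^ k) ^ 4 := by rw [← pow_mul, mul_comm]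
  have e3 : t ^ (k * (4 * p + 3)) = t ^ (4 * k * p) * (t ^ k) ^ 3 := by
    rw [← pow_mul, ← pow_add]; ring
  -- The exponent is the lower writhe, k(4p + 3) - 2k.
  have e3' : t ^ (k * (4 * p + 1)) = t ^ (4 * k * p) * t ^ k := by
    rw [← pow_add]; ring
  have e4 : t ^ (2 * k) = (t ^ k) ^ 2 := by rw [← pow_mul, mul_comm]
  have e5 : t ^ (3 * k) = (t ^ k) ^ 3 := by rw [← pow_mul, mul_comm]
  rw [e2] at hs
  rw [e3, e4, e5] at hx
  rw [e3', pow_succ t k]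
  rw [e4] at hk4
  rw [e5] at hq
  generalize t ^ (4 * k * p) = u at *
  generalize t ^ k = w at *
  have hq' : (1 + t + t ^ 2) * Q = w ^ 3 - 1 := by
    refine mul_left_cancel₀ h1 ?_
    linear_combination hq
  rw [neg_eq_iff_eq_neg, div_eq_iff h3]
  refine mul_left_cancel₀ hk1 ?_
  refine mul_left_cancel₀ hk2 ?_
  refine mul_left_cancel₀ hk4 ?_
  generalize t⁻¹ = r at *
  linear_combination -(t * w) * (w - 1) * hx + t * w * (1 + t + t ^ 2) * hs +
    (u - 1) * t * w * hq' + t * w * (u - 1) * (w - 1) * w ^ 3 * (1 + t) * hi +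
    (w ^ 4 - 1) * (1 - w) * hi

end
end BraidGroup

/-! ### Writhe constraints and Alexander polynomials under equal Jones polynomials -/

namespace BraidGroup

theorem exponents {β γ : BraidGroup 3} (hV : β.jones = γ.jones) {k : ℕ} (hk1 : 1 < k)
    (hk : β.writhe = γ.writhe + 2 * (k : ℤ)) :
    (Even β.writhe → k = 2 ∧ ∃ j : ℤ, β.writhe = 8 * j + 2) ∧
    (Odd β.writhe → Odd k ∧ ∃ j : ℤ, β.writhe = k * (4 * j + 3)) := by
  refine exponent_of_roots k hk1 _ fun ζ hζ => ?_
  -- The trace relation is parametrised by √t, so a square root of ζ is needed.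
  obtain ⟨c, hc⟩ := IsAlgClosed.exists_pow_nat_eq (ζ : ℂ) two_pos
  have hc0 : c ≠ 0 := by
    rintro rfl
    exact ζ.ne_zero (by rw [← hc]; norm_num)
  obtain ⟨s, rfl⟩ : ∃ s : ℂˣ, s ^ 2 = ζ := ⟨Units.mk0 c hc0, by ext; simpa using hc⟩
  generalize ht : s ^ 2 = t at *
  have h1 : (t : ℂ) ^ k - 1 ≠ 0 := fun h => by
    have : (t : ℂ) ^ k = 1 := by linear_combination h
    rw [mul_comm 2 k, pow_mul, this] at hζ
    norm_num at hζ
  -- A primitive cube root of unity t would give w³ = 1 for w = t^k, incompatible with (1 + w)(1 +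
  -- w²) = 0.
  have h3 : (1 + t + t ^ 2 : ℂ) ≠ 0 := fun h => by
    have h3 : (t : ℂ) ^ 3 = 1 := by linear_combination (t - 1 : ℂ) * h
    have h3k : ((t : ℂ) ^ k) ^ 3 = 1 := by rw [← pow_mul, mul_comm, pow_mul, h3, one_pow]
    rw [mul_comm 2 k, pow_mul] at hζ
    generalize (t : ℂ) ^ k = w at *
    have : w ^ 2 + w + 1 = 0 := (mul_eq_zero.1 (by linear_combination h3k :
      (w - 1) * (w ^ 2 + w + 1) = 0)).resolve_left h1
    exact one_ne_zero (by linear_combination hζ - h3k - this : (1 : ℂ) = 0)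
  have := burauTrace_mul hV hk s (by rw [ht]; exact h3) (by rw [ht]; exact h1)
  rw [ht, hζ, mul_zero, eq_comm, neg_eq_zero, mul_eq_zero] at this
  have hi : (t * (t : ℂ)⁻¹ : ℂ) = 1 := mul_inv_cancel₀ t.ne_zero
  refine this.imp (fun h => ?_) (fun h => ?_)
  · linear_combination (t : ℂ) * h - hi
  · rw [← h, Units.val_zpow_eq_zpow_val, Units.val_neg]

theorem burauTrace_tVar_mul {β γ : BraidGroup 3} (hV : β.jones = γ.jones) {k : ℕ} (hk0 : k ≠ 0)
    (hk : β.writhe = γ.writhe + 2 * (k : ℤ)) :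
    burauTrace (sqrtT ^ 2) β * ((1 + tVar ^ k) * (1 + tVar ^ (2 * k))) =
      -((tVar + tVar⁻¹) * (tVar ^ (3 * k) + (-tVar) ^ β.writhe)) :=
  burauTrace_mul hV hk sqrtT one_add_tVar_add_sq_ne_zero (tVar_pow_sub_one_ne_zero hk0)

theorem tVar_ne_zero : tVar ≠ 0 := pow_ne_zero _ sqrtT.ne_zero

/-- The formula for the trace was obtained by cancelling t^k - 1 and cannot be applied directly at t
= 1. With t⁻¹ cleared it is lifted to Laurent polynomials first and then specialised, giving 4x + 4
= 0. -/
theorem burauTrace_one_eq_neg_one {β γ : BraidGroup 3} (hV : β.jones = γ.jones) {k : ℕ}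
    (hk0 : k ≠ 0) (hk : β.writhe = γ.writhe + 2 * (k : ℤ)) (he : Even β.writhe) :
    burauTrace (1 : ℤˣ) β = -1 := by
  have hev : ∀ {Q : Type} [CommRing Q] (u : Qˣ),
      evalUnit u (burauTrace (zVar ^ 2) β * (↑(zVar ^ 2) *
        ((1 + ↑(zVar ^ 2) ^ k) * (1 + ↑(zVar ^ 2) ^ (2 * k)))) +
        (1 + ↑(zVar ^ 2) ^ 2) * (↑(zVar ^ 2) ^ (3 * k) + ↑((zVar ^ 2) ^ β.writhe))) =
      burauTrace (u ^ 2) β * (↑(u ^ 2) * ((1 + ↑(u ^ 2) ^ k) * (1 + ↑(u ^ 2) ^ (2 * k)))) +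
        (1 + ↑(u ^ 2) ^ 2) * (↑(u ^ 2) ^ (3 * k) + ↑((u ^ 2) ^ β.writhe)) := by
    intro Q _ u
    have hv : ∀ w : (ℤ[T;T⁻¹])ˣ, evalUnit u (w : ℤ[T;T⁻¹]) =
      (Units.map (evalUnit u : ℤ[T;T⁻¹] →* Q) w : Q) := fun w => rfl
    simp only [map_mul, map_add, map_one, map_pow (evalUnit u), map_burauTrace, hv, map_zpow]
    simp only [map_pow, map_evalUnit_zVar]
  have h0 := (injective_iff_map_eq_zero _).1
    (evalUnit_injective RatFunc.C sqrtT eval₂_sqrtT_eq_zero) _ ((hev sqrtT).trans (by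
      have h := burauTrace_tVar_mul hV hk0 hk
      have hi : tVar * tVar⁻¹ = 1 := mul_inv_cancel₀ tVar_ne_zero
      rw [Units.val_zpow_eq_zpow_val, tVar_eq]
      rw [he.neg_zpow] at h
      linear_combination tVar * h - (tVar ^ (3 * k) + tVar ^ β.writhe) * hi))
  have h1 := hev (1 : ℤˣ)
  rw [h0, map_zero] at h1
  simp only [one_pow, one_zpow, Units.val_one] at h1
  linarith

theorem sqrtT_zpow_mul_alexander (β : BraidGroup 3) :
    (sqrtT : RatFunc ℚ) ^ β.writhe * β.alexander = (-1) ^ β.writhe *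
      (tVar * (1 - burauTrace (sqrtT ^ 2) β + (-tVar) ^ β.writhe) / (1 + tVar + tVar ^ 2)) := by
  have hs := sqrtT.ne_zero
  rw [alexander_eq]
  have : (sqrtT : RatFunc ℚ) ^ β.writhe * (-(sqrtT : RatFunc ℚ)⁻¹) ^ β.writhe = (-1) ^ β.writhe := by
    rw [← mul_zpow, mul_neg, mul_inv_cancel₀ hs]
  rw [← this]
  ring

theorem sqrtT_zpow_sub_two_mul_alexander (β : BraidGroup 3) :
    (sqrtT : RatFunc ℚ) ^ (β.writhe - 2) * β.alexander = (-1) ^ β.writhe *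
      ((1 - burauTrace (sqrtT ^ 2) β + (-tVar) ^ β.writhe) / (1 + tVar + tVar ^ 2)) := by
  have hs := sqrtT.ne_zero
  have h := sqrtT_zpow_mul_alexander β
  have e : (sqrtT : RatFunc ℚ) ^ (2 : ℤ) = tVar := rfl
  have ht := tVar_ne_zero
  rw [zpow_sub₀ hs, e, div_mul_eq_mul_div, h]
  field_simp

theorem conway_of_writhe_diff_two {β γ : BraidGroup 3} (hV : β.jones = γ.jones)
    (hk : β.writhe = γ.writhe + 2) : β.conway = conwayTorus (β.writhe - 1) := by
  rw [conwayTorus, conway_eq_iff, alexander_eq₂, alexander_eq]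
  have hw : ((sigma 0 : BraidGroup 2) ^ (β.writhe - 1)).writhe = β.writhe - 1 := by
    have := writhe_sigma (n := 2) 0
    simp only [writhe, map_zpow, toAdd_zpow] at this ⊢
    rw [this]
    simp
  rw [hw]
  have hx := burauTrace_tVar_mul hV one_ne_zero (by simpa using hk)
  have hs := sqrtT.ne_zero
  have ht := tVar_ne_zero
  have h1 := one_add_tVar_pow_ne_zero 1
  have h2 := one_add_tVar_pow_ne_zero 2
  have h3 := one_add_tVar_add_sq_ne_zero
  rw [pow_one] at h1
  simp only [pow_one, mul_one] at hx
  set a := β.writhe with ha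
  have e1 : (-tVar) ^ a = (-tVar) ^ (a - 1) * (-tVar) := by
    rw [zpow_sub_one₀ (neg_ne_zero.2 ht), inv_mul_cancel_right₀ (neg_ne_zero.2 ht)]
  have hn : -(sqrtT : RatFunc ℚ)⁻¹ ≠ 0 := neg_ne_zero.2 (inv_ne_zero hs)
  have e2 : (-(sqrtT : RatFunc ℚ)⁻¹) ^ a =
      (-(sqrtT : RatFunc ℚ)⁻¹) ^ (a - 1) * (-(sqrtT : RatFunc ℚ)⁻¹) := by
    rw [zpow_sub_one₀ hn, inv_mul_cancel_right₀ hn]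
  have e3 : (sqrtT : RatFunc ℚ) ^ (a - 1) =
      (-(sqrtT : RatFunc ℚ)⁻¹) ^ (a - 1) * (-tVar) ^ (a - 1) := by
    rw [← mul_zpow, tVar]
    congr 1
    field_simp
  rw [e1] at hx ⊢
  rw [e2, e3]
  generalize (-(sqrtT : RatFunc ℚ)⁻¹) ^ (a - 1) = M
  generalize (-tVar) ^ (a - 1) = A at *
  generalize burauTrace (sqrtT ^ 2) β = x at *
  -- Since t + t⁻¹ = (1 + t²)/t, the factor 1 + t² = 1 + t^(2k) cancels when k = 1.
  have hx' : x * (1 + tVar) = A - tVar ^ 2 := by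
    refine mul_left_cancel₀ h2 ?_
    have hi : tVar * tVar⁻¹ = 1 := mul_inv_cancel₀ ht
    linear_combination hx - (tVar ^ 2 - A) * hi
  have hx'' : x = (A - tVar ^ 2) / (1 + tVar) := by rw [← hx']; field_simp
  rw [hx'']
  have hts : tVar * (sqrtT : RatFunc ℚ)⁻¹ = sqrtT := by rw [tVar]; field_simp
  have hnum : 1 - (A - tVar ^ 2) / (1 + tVar) + A * -tVar =
      (1 + tVar + tVar ^ 2) * (1 - A) / (1 + tVar) := by
    field_simp
    ring
  rw [hnum]
  calc _ = M * -(tVar * (sqrtT : RatFunc ℚ)⁻¹) * (1 - A) / (1 + tVar) := by field_simp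
    _ = _ := by rw [hts]; ring

end BraidGroup

open BraidGroup in
theorem mainTheorem9 (β γ : BraidGroup 3)
    (hw : max γ.writhe (-1) < β.writhe) (hV : β.jones = γ.jones) :
    β.numComponents ≠ 3 ∧ γ.numComponents ≠ 3 ∧
    ∃ k : ℕ, β.writhe = γ.writhe + 2 * (k : ℤ) ∧
      (k = 1 → β.conway = BraidGroup.conwayTorus (β.writhe - 1)) ∧
      (β.numComponents = 1 → 1 < k →
        k = 2 ∧ 2 ≤ β.writhe ∧
        (β.writhe = 2 → β.conway = 1 ∧ γ.conway = 1) ∧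
        (2 < β.writhe → ∃ p : ℕ, 0 < p ∧ β.writhe = 2 * (4 * (p : ℤ) + 1) ∧
          (BraidGroup.sqrtT : RatFunc ℚ) ^ (β.writhe - 2) * β.alexander =
            ∑ j ∈ Finset.range (2 * p), (-1) ^ j * BraidGroup.tVar ^ (4 * j) *
                (1 - BraidGroup.tVar + BraidGroup.tVar ^ 3) +
              BraidGroup.tVar ^ (8 * p) ∧
          (BraidGroup.sqrtT : RatFunc ℚ) ^ γ.writhe * γ.alexander =
            1 - BraidGroup.tVar ^ 2 +
              BraidGroup.tVar ^ 3 *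
                ∑ j ∈ Finset.range (2 * p - 1), (-1) ^ j * BraidGroup.tVar ^ (4 * j) *
                  (1 - BraidGroup.tVar + BraidGroup.tVar ^ 3))) ∧
      (β.numComponents = 2 → 1 < k →
        Odd k ∧ ∃ p : ℕ, β.writhe = (k : ℤ) * (4 * (p : ℤ) + 3) ∧
          (BraidGroup.sqrtT : RatFunc ℚ) ^ (β.writhe - 2) * β.alexander =
            ∑ j ∈ Finset.range p, BraidGroup.tVar ^ (4 * k * j) *
                (∑ x ∈ Finset.range k, BraidGroup.tVar ^ (3 * x) * (-1 + BraidGroup.tVar) +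
                  BraidGroup.tVar ^ (3 * k - 1) * (-1 + BraidGroup.tVar ^ k)) +
              BraidGroup.tVar ^ (4 * k * p) *
                ∑ x ∈ Finset.range k, BraidGroup.tVar ^ (3 * x) * (-1 + BraidGroup.tVar) ∧
          (BraidGroup.sqrtT : RatFunc ℚ) ^ γ.writhe * γ.alexander =
            -(1 - BraidGroup.tVar ^ k) +
              BraidGroup.tVar ^ (k + 1) *
                ∑ j ∈ Finset.range p, BraidGroup.tVar ^ (4 * k * j) *
                  (∑ x ∈ Finset.range k, BraidGroup.tVar ^ (3 * x) * (-1 + BraidGroup.tVar) +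
                    BraidGroup.tVar ^ (3 * k - 1) * (-1 + BraidGroup.tVar ^ k))) := by
  obtain ⟨hw1, hw2⟩ := max_lt_iff.1 hw
  obtain ⟨hn, c, hc⟩ := numComponents_eq hV
  obtain ⟨k, rfl⟩ : ∃ k : ℕ, c = k := Int.eq_ofNat_of_zero_le (by omega)
  have hk : β.writhe = γ.writhe + 2 * (k : ℤ) := by omega
  have hk0 : 0 < k := by omega
  have hx := burauTrace_tVar_mul hV hk0.ne' hk
  have hy : burauTrace (sqrtT ^ 2) γ = tVar ^ k * (burauTrace (sqrtT ^ 2) β + (tVar + tVar⁻¹)) -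
      (tVar + tVar⁻¹) := burauTrace_of_jones hV hk sqrtT
  have h3 := one_add_tVar_add_sq_ne_zero
  have ht := tVar_ne_zero
  have hβ3 : β.numComponents ≠ 3 := fun h => by
    rcases numComponents_cases β with ⟨n1, -, -⟩ | ⟨n1, -, -⟩ | ⟨-, e1, t1⟩
    · omega
    · omega
    · have := burauTrace_one_eq_neg_one hV hk0.ne' hk e1
      omega
  refine ⟨hβ3, hn ▸ hβ3, k, hk, ?_, ?_, ?_⟩
  · rintro rfl
    exact conway_of_writhe_diff_two hV (by simpa using hk)
  · intro hμ hk1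
    have hev : Even β.writhe := by
      rcases numComponents_cases β with ⟨n1, e1, -⟩ | ⟨n1, e1, -⟩ | ⟨n1, e1, -⟩
      · exact e1
      all_goals omega
    obtain ⟨rfl, j, hj⟩ := (exponents hV hk1 hk).1 hev
    -- From a = 8j + 2 > -1.
    obtain ⟨p, rfl⟩ : ∃ p : ℕ, j = p := Int.eq_ofNat_of_zero_le (by omega)
    have hevγ : Even γ.writhe := by
      rw [hk, Int.even_add] at hev
      exact hev.2 (even_two_mul _)
    have hA : (-tVar) ^ β.writhe = tVar ^ (8 * p + 2) := by
      rw [hev.neg_zpow, hj]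
      norm_cast
    have h2 := one_add_tVar_pow_ne_zero 2
    have h4 := one_add_tVar_pow_ne_zero 4
    rw [hA] at hx
    have hβ := sqrtT_zpow_sub_two_mul_alexander β
    have hγ := sqrtT_zpow_mul_alexander γ
    rw [hev.neg_one_zpow, one_mul, hA] at hβ
    rw [hevγ.neg_one_zpow, one_mul, hy] at hγ
    have key := knot_upper ht p h3 h2 h4 hx
    rw [key] at hβ
    refine ⟨rfl, by omega, fun h => ?_, fun h => ⟨p, by omega, by omega, hβ, ?_⟩⟩
    · obtain rfl : p = 0 := by omega
      rw [conway_eq_one_iff, conway_eq_one_iff]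
      constructor
      · simpa [h] using hβ
      -- For p = 0 the exponent b = 8p - 2 is negative and `knot_lower` does not apply; the value is
      -- computed directly from x = -t.
      · have hb : γ.writhe = -2 := by omega
        have hA' : (-tVar) ^ γ.writhe = (tVar ^ 2)⁻¹ := by
          rw [hb]
          simp [zpow_neg]
        have hS : (sqrtT : RatFunc ℚ) ^ γ.writhe = tVar⁻¹ := by
          rw [hb, tVar, zpow_neg]
          norm_cast
        have hx' : burauTrace (sqrtT ^ 2) β = -tVar := by
          refine mul_right_cancel₀ (mul_ne_zero h2 h4) ?_
          rw [hx]
          field_simp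
          ring
        rw [hA', hS, hx'] at hγ
        have := congrArg (tVar * ·) hγ
        simp only [mul_inv_cancel_left₀ ht] at this
        rw [this]
        field_simp
        ring
    · rw [hγ, ← knot_lower ht p (by omega) h3 h2 h4 hx]
      have : (-tVar) ^ γ.writhe = tVar ^ (8 * p - 2) := by
        rw [hevγ.neg_zpow, ← zpow_natCast]
        congr 1
        omega
      rw [this]
  · intro hμ hk1
    have hod : Odd β.writhe := by
      rcases numComponents_cases β with ⟨n1, e1, -⟩ | ⟨n1, e1, -⟩ | ⟨n1, e1, -⟩
      · omega
      · exact e1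
      · omega
    have hodγ : Odd γ.writhe := by
      rw [hk, Int.odd_add] at hod
      exact hod.2 (by simp)
    obtain ⟨hko, j, hj⟩ := (exponents hV hk1 hk).2 hod
    have hj0 : 0 ≤ j := by
      by_contra hneg
      -- A negative j would make a ≤ -k, against a > -1.
      have : (k : ℤ) * (4 * j + 3) ≤ k * (-1) :=
        mul_le_mul_of_nonneg_left (by omega) (by omega)
      omega
    obtain ⟨p, rfl⟩ : ∃ p : ℕ, j = p := Int.eq_ofNat_of_zero_le hj0
    have hA : (-tVar) ^ β.writhe = -tVar ^ (k * (4 * p + 3)) := by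
      rw [hod.neg_zpow, hj]
      norm_cast
    have hB : (-tVar) ^ γ.writhe = -tVar ^ (k * (4 * p + 1)) := by
      rw [hodγ.neg_zpow, ← zpow_natCast]
      congr 2
      push_cast
      linarith
    rw [hA, ← sub_eq_add_neg] at hx
    have h1 : tVar - 1 ≠ 0 := tVar_sub_one_ne_zero
    have hk2 := one_add_tVar_pow_ne_zero k
    have hk4 := one_add_tVar_pow_ne_zero (2 * k)
    have hk5 := tVar_pow_sub_one_ne_zero hk0.ne'
    refine ⟨hko, p, hj, ?_, ?_⟩
    · rw [sqrtT_zpow_sub_two_mul_alexander, hod.neg_one_zpow, neg_one_mul, hA,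
        ← link_upper ht k p hk0 h3 h1 hk5 hk2 hk4 hx]
      simp only [sub_eq_add_neg]
    · rw [sqrtT_zpow_mul_alexander, hodγ.neg_one_zpow, neg_one_mul, hB, hy,
        ← link_lower ht k p hk0 h3 h1 hk5 hk2 hk4 hx]
      simp only [sub_eq_add_neg]
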